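/- Let $T>0$, let $f_0,f_1,\dots,f_m$ be analytic vector fields on $\mathbb{R}^n$, and consider the affine control system $\dot x=f_0(x)+\sum_{i=1}^m u_if_i(x)$, $x(0)=0$, with controls $u\in L^2([0,T],\mathbb{R}^m)$ and cost $C(u)=\int_0^T\sum_{i=1}^m u_i(t)^2\,dt$. Let $\Omega$ be the set of admissible controls, i.e. those $u$ whose trajectory $x_u$ is defined on all of $[0,T]$; let $E:\Omega\to\mathbb{R}^n$, $E(u)=x_u(T)$, be the end-point mapping, and let $\widetilde E:\Omega\to\mathbb{R}^n\times\mathbb{R}$ be the end-point mapping of the extended system obtained by adding the equation $\dot x^0=\sum_i u_i^2$, $x^0(0)=0$. Let $S(x)=\inf\{C(u): u\in\Omega,\ E(u)=x\}\in[0,+\infty]$ be the value function, $M_r(T)=S^{-1}(r)$, $M_{\le r}(T)=S^{-1}([0,r])$, and $\widetilde M_{\le r}(T)=\{(x,S(x)): x\in M_{\le r}(T)\}\subset\mathbb{R}^n\times\mathbb{R}$. A control $u\in\Omega$ is minimizing if $C(u)=S(E(u))$, and abnormal if $dE(u)$ is not surjective. A Lagrange multiplier of $u$ is a pair $(p,p^0)\in(\mathbb{R}^n)^*\times\mathbb{R}$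 with $p\circ dE(u)=-p^0\,dC(u)$; $u\in\Omega$ is extremal if it has a nonzero Lagrange multiplier. A $C^1$ stratification of a set $Z$ near a point $P$ is a partition of $Z\cap U$, for some open neighbourhood $U$ of $P$, into nonempty locally closed $C^1$ submanifolds (strata), locally finite in $U$, such that whenever a stratum $N'$ meets $\overline N\setminus N$ for a stratum $N$, then $N'\subset\overline N\setminus N$ and $\dim N'<\dim N$. A stratum $N$ of $Z$ with $P\in\overline N$ is tangent at $P$ to a linear subspace $H$ if (i) for every $\varepsilon>0$ there is a neighbourhood of $P$ such that for all $Q\in N$ in it and all $w\in T_QN$, $\operatorname{dist}(w,H)\le\varepsilon\|w\|$; and (ii) whenever $\gamma:(0,1)\to\overline N\cap Z$ is $C^1$ with $\gamma(\tau)\to P$ and $\gamma'(\tau)\to w$ as $\tau\to0$, one has $w\in H$. Theorem. Let $r>0$ be such that every control of cost at most $r$ is admissible. Let $A\in M_{\le r}(T)$, $r_0=S(A)$, and suppose that there is a unique minimizing control $u$ with $E(u)=A$, that $u$ is abnormal, and that $\operatorname{Im}dE(u)$ is a hyperplane of $\mathbb{R}^n$. Then $E$ and $\widetilde E$ are Fréchet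 differentiable at $u$, and: 1. Suppose that $u$ has a unique nonzero Lagrange multiplier up to scalars. Then $\operatorname{Im}d\widetilde E(u)$ is a hyperplane of $\mathbb{R}^n\times\mathbb{R}$, and for every $C^1$ stratification of $\widetilde M_{\le r}(T)$ near $\widetilde A=(A,r_0)$, every stratum having $\widetilde A$ in its closure is tangent at $\widetilde A$ to $\operatorname{Im}d\widetilde E(u)$. 2. Let $r_1<r$ with $A\in\overline{M_{r_1}(T)}$. Then $r_1\ge r_0$. Suppose moreover that $u$ is the only extremal control of cost at most $r_1$ steering $0$ to $A$ (this holds automatically if $r_1=r_0$) and that either $r_1>r_0$ or $u$ has a unique nonzero Lagrange multiplier up to scalars. Then for every $C^1$ stratification of $M_{r_1}(T)$ near $A$, every stratum having $A$ in its closure is tangent at $A$ to $\operatorname{Im}dE(u)$. -/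

import Mathlib

open MeasureTheory Set Filter Topology

noncomputable section

/-- The space `L²([0,T], ℝᵐ)` of controls. -/
abbrev Control (T : ℝ) (m : ℕ) : Type :=
  Lp (EuclideanSpace ℝ (Fin m)) 2 (volume.restrict (Icc (0 : ℝ) T))

section Systems

variable {X : Type*} [NormedAddCommGroup X] [NormedSpace ℝ X]

/-- The control-affine right-hand side `(x, w) ↦ f₀(x) + ∑ wᵢ fᵢ(x)`. -/
def affineField {m : ℕ} (f₀ : X → X) (f : Fin m → X → X) :
    X → EuclideanSpace ℝ (Fin m) → X :=
  fun x w => f₀ x + ∑ i, w i • f i x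

/-- The extended system on `X × ℝ`, in which the last coordinate satisfies `ẋ⁰ = ∑ wᵢ²`. -/
def extendedField {m : ℕ} (F : X → EuclideanSpace ℝ (Fin m) → X) :
    X × ℝ → EuclideanSpace ℝ (Fin m) → X × ℝ :=
  fun y w => (F y.1 w, ∑ i, w i ^ 2)

/-- `x` is a solution on `[0,T]` of `ẋ = F(x,u)`, `x(0) = 0`, in the integral sense. -/
def IsTrajectory {m : ℕ} (F : X → EuclideanSpace ℝ (Fin m) → X) (T : ℝ) (u : Control T m)
    (x : ℝ → X) : Prop :=
  ContinuousOn x (Icc 0 T) ∧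
  IntervalIntegrable (fun s => F (x s) (u s)) volume 0 T ∧
  ∀ t ∈ Icc (0 : ℝ) T, x t = ∫ s in (0 : ℝ)..t, F (x s) (u s)

/-- The domain `Ω` of the end-point mapping: the controls whose trajectory is well defined on the
whole of `[0,T]`. -/
def admissible {m : ℕ} (F : X → EuclideanSpace ℝ (Fin m) → X) (T : ℝ) : Set (Control T m) :=
  {u | ∃ x, IsTrajectory F T u x}

open Classical in
/-- The end-point mapping `u ↦ x_u(T)`, extended by `0` outside its domain `Ω`. -/
def endpoint {m : ℕ} (F : X → EuclideanSpace ℝ (Fin m) → X) (T : ℝ) (u : Control T m) : X :=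
  if h : ∃ x, IsTrajectory F T u x then h.choose T else 0

/-- The cost `C(u) = ∫₀ᵀ ∑ uᵢ(t)² dt`. -/
def cost {m : ℕ} (T : ℝ) (u : Control T m) : ℝ :=
  ∫ t in (0 : ℝ)..T, ∑ i, (u t i) ^ 2

/-- The value function `S`: the infimum of the costs of the controls steering `0` to `x` in time
`T`; it is `+∞` if there are none. -/
def valueFunction {m : ℕ} (F : X → EuclideanSpace ℝ (Fin m) → X) (T : ℝ) (x : X) : EReal :=
  ⨅ v ∈ {v : Control T m | v ∈ admissible F T ∧ endpoint F T v = x}, (cost T v : EReal)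

/-- `M_r(T)`. -/
def levelSet {m : ℕ} (F : X → EuclideanSpace ℝ (Fin m) → X) (T r : ℝ) : Set X :=
  {x | valueFunction F T x = (r : EReal)}

/-- `M_{≤ r}(T)`. -/
def sublevelSet {m : ℕ} (F : X → EuclideanSpace ℝ (Fin m) → X) (T r : ℝ) : Set X :=
  {x | valueFunction F T x ≤ (r : EReal)}

/-- The augmented sublevel set, i.e. the set of points `(x, S(x))` with `x ∈ M_{≤ r}(T)`. -/
def augmentedSublevelSet {m : ℕ} (F : X → EuclideanSpace ℝ (Fin m) → X) (T r : ℝ) :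
    Set (X × ℝ) :=
  {y | y.1 ∈ sublevelSet F T r ∧ valueFunction F T y.1 = (y.2 : EReal)}

/-- `u` is a minimizing control (among the controls with the same end-point). -/
def IsMinimizing {m : ℕ} (F : X → EuclideanSpace ℝ (Fin m) → X) (T : ℝ) (u : Control T m) :
    Prop :=
  u ∈ admissible F T ∧
  ∀ v ∈ admissible F T, endpoint F T v = endpoint F T u → cost T u ≤ cost T v

/-- `u` is abnormal (singular): the differential of the end-point mapping is not onto. -/
def IsAbnormal {m : ℕ} (F : X → EuclideanSpace ℝ (Fin m) → X) (T : ℝ) (u : Control T m) : Prop :=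
  u ∈ admissible F T ∧ ¬ Function.Surjective (fderiv ℝ (endpoint F T) u)

/-- The space of Lagrange multipliers `(p, p⁰)` of `u`: the solutions of
`p ∘ dE(u) = - p⁰ dC(u)`. -/
def multipliers {m : ℕ} (F : X → EuclideanSpace ℝ (Fin m) → X) (T : ℝ) (u : Control T m) :
    Submodule ℝ ((X →L[ℝ] ℝ) × ℝ) where
  carrier := {q | q.1.comp (fderiv ℝ (endpoint F T) u) = -q.2 • fderiv ℝ (cost T) u}
  add_mem' := by
    intro a b ha hb
    simp only [mem_ofPred_eq, Prod.fst_add, Prod.snd_add, ContinuousLinearMap.add_comp] at *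
    rw [ha, hb, neg_add, add_smul]
  zero_mem' := by simp
  smul_mem' := by
    intro c a ha
    simp only [mem_ofPred_eq, Prod.smul_fst, Prod.smul_snd, ContinuousLinearMap.smul_comp] at *
    rw [ha, smul_smul, smul_eq_mul, mul_neg]

/-- `u` is an extremal control: it has a nonzero Lagrange multiplier. -/
def IsExtremal {m : ℕ} (F : X → EuclideanSpace ℝ (Fin m) → X) (T : ℝ) (u : Control T m) : Prop :=
  u ∈ admissible F T ∧ multipliers F T u ≠ ⊥

/-- `u` has exactly one Lagrange multiplier `(p, p⁰) ≠ 0` up to a scalar. -/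
def HasUniqueMultiplier {m : ℕ} (F : X → EuclideanSpace ℝ (Fin m) → X) (T : ℝ)
    (u : Control T m) : Prop :=
  Module.finrank ℝ (multipliers F T u) = 1

end Systems

section Strata

variable {V : Type*} [NormedAddCommGroup V] [NormedSpace ℝ V]

/-- `N` is a (locally closed, embedded) `C¹` submanifold of dimension `d` of `V`: near each of its
points a `C¹` diffeomorphism between open sets straightens it to a `d`-dimensional subspace. -/
def IsC1Submanifold (d : ℕ) (N : Set V) : Prop :=
  ∀ P ∈ N, ∃ (K : Submodule ℝ V) (φ : OpenPartialHomeomorph V V),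
    Module.finrank ℝ K = d ∧ P ∈ φ.source ∧
    ContDiffOn ℝ 1 φ φ.source ∧ ContDiffOn ℝ 1 φ.symm φ.target ∧
    ∀ Q ∈ φ.source, Q ∈ N ↔ φ Q ∈ K

/-- `𝒮` is a `C¹` stratification of the set `Z` near the point `P`: for some open neighbourhood
`U` of `P`, it is a locally finite (in `U`) partition of `Z ∩ U` into `C¹` submanifolds which
satisfies the frontier condition. Here the frontier of `N` is `closure N \ N`. -/
def IsC1StratificationNear (Z : Set V) (P : V) (𝒮 : Set (Set V)) : Prop :=
  ∃ (U : Set V) (dim : Set V → ℕ), IsOpen U ∧ P ∈ U ∧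
    (∀ N ∈ 𝒮, N.Nonempty ∧ IsC1Submanifold (dim N) N) ∧
    𝒮.PairwiseDisjoint id ∧
    ⋃₀ 𝒮 = Z ∩ U ∧
    (∀ Q ∈ U, ∃ W ∈ 𝓝 Q, {N ∈ 𝒮 | (N ∩ W).Nonempty}.Finite) ∧
    ∀ N ∈ 𝒮, ∀ N' ∈ 𝒮, (N' ∩ (closure N \ N)).Nonempty →
      N' ⊆ closure N \ N ∧ dim N' < dim N

/-- The tangent vectors at `Q` to the submanifold `N`: the velocities at `Q` of the `C¹` curves
drawn on `N`. -/
def tangentVectors (N : Set V) (Q : V) : Set V :=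
  {w | ∃ (γ : ℝ → V) (δ : ℝ), 0 < δ ∧ ContDiffOn ℝ 1 γ (Ioo (-δ) δ) ∧
    (∀ t ∈ Ioo (-δ) δ, γ t ∈ N) ∧ γ 0 = Q ∧ deriv γ 0 = w}

/-- The stratum `N` of the set `Z` is tangent at `P` to the subspace `H`:
the tangent spaces of `N` at points tending to `P` make an angle with `H` which tends to zero, and
every `C¹` curve of `Z`, drawn on the closure of `N` and tending to `P`, whose velocity has a
limit, has its limit velocity in `H`. -/
def StratumTangentAt (Z N : Set V) (P : V) (H : Submodule ℝ V) : Prop :=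
  (∀ ε > 0, ∀ᶠ Q in 𝓝[N] P, ∀ w ∈ tangentVectors N Q,
    Metric.infDist w (H : Set V) ≤ ε * ‖w‖) ∧
  ∀ (γ : ℝ → V) (w : V), ContDiffOn ℝ 1 γ (Ioo 0 1) →
    (∀ τ ∈ Ioo (0 : ℝ) 1, γ τ ∈ closure N ∩ Z) →
    Tendsto γ (𝓝[>] 0) (𝓝 P) → Tendsto (deriv γ) (𝓝[>] 0) (𝓝 w) → w ∈ H

end Strata

end

/-! Write `C` for the cost, `E~ = (E, C)` for the extended end-point map and `S` for the value
function. The heart is a first-order statement about the graph of `S`,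
`exists_multiplier_annihilating`: the velocity `w` of any `C¹` curve drawn on the graph is
annihilated by a unit Lagrange multiplier of some minimizing control over the base point. Suppose
not. Lift the curve `γ` to minimizing controls `v(t)`; they converge strongly to a minimizer `v₀`,
because a weak limit exists and the costs converge to its cost. If no multiplier of `v₀` kills `w`,
then `Im dE~(v₀) + ℝw` is the whole space and `(v, t) ↦ E~(v) - γ(t)` is a submersion at `(v₀, 0)`.
Every zero of this map near `(v₀, 0)` is a minimizer, where `dE~` is not onto
(`IsMinimizing.not_surjective`), so the kernel of the differential there lies in `dt = 0` and `t` is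
constant on the zero set (`eventually_snd_eq_zero_of_submersion`). The zeros `(v(t), t)` contradict
this.

Tangency then becomes a question about limits of multipliers. By compactness of the unit sphere, if
all limits of unit multipliers are multiples of one covector `q₁`, tangent vectors at nearby points
are almost in `ker q₁` (`eventually_abs_pairing_le`). Such limits are multipliers of the weak limit
of the controls (`mem_multipliers_of_tendsto`). On the graph this weak limit is the unique minimizer
`u`, whose multipliers form a line with kernel `Im dE~(u)`. On a level set it is an extremal of cost
at most `r₁` reaching `A`, hence `u`; if `r₁ > r₀`, cost is lost in the limit and testing the
multiplier identity on the controls themselves forces `p⁰ = 0` (`snd_eq_zero_of_tendsto`), so that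
`p` spans the annihilator of the hyperplane `Im dE(u)`.

All of this rests on weak continuity: `E` is weakly continuous and `dE` is continuous from the weak
to the norm topology. Both follow from one persistence theorem for systems linear in the controls,
`IsSol.eventually_exists`, applied to the given system and to the system satisfied by a solution
together with its divided differences. Limits along ultrafilters play the role of subsequences. -/

noncomputable section
/-- Scalar square-integrable controls on `[0,T]`. -/
abbrev ScalarControl (T : ℝ) : Type := Lp ℝ 2 (volume.restrict (Icc (0 : ℝ) T))

/-! ### Integral estimates and a Gronwall inequality for square-integrable controls -/

section Driftless

variable {Y : Type*} [NormedAddCommGroup Y] [NormedSpace ℝ Y]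

theorem integrableOn_control_smul {T : ℝ} (c : ScalarControl T) {y : ℝ → Y}
    (hy : ContinuousOn y (Icc 0 T)) : IntegrableOn (fun s => c s • y s) (Icc 0 T) := by
  have hc : Integrable (fun s => c s) (volume.restrict (Icc (0 : ℝ) T)) :=
    (Lp.memLp c).integrable (by norm_num)
  obtain ⟨M, hM⟩ := (isCompact_Icc.image_of_continuousOn hy).isBounded.exists_norm_le
  refine hc.smul_bdd M (hy.aestronglyMeasurable_of_isCompact isCompact_Icc measurableSet_Icc) ?_
  filter_upwards [ae_restrict_mem measurableSet_Icc] with s hs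
  exact hM _ (mem_image_of_mem _ hs)

theorem intervalIntegrable_control_smul {T : ℝ} (c : ScalarControl T) {y : ℝ → Y}
    (hy : ContinuousOn y (Icc 0 T)) {a b : ℝ} (ha : a ∈ Icc 0 T) (hb : b ∈ Icc 0 T) :
    IntervalIntegrable (fun s => c s • y s) volume a b := by
  rw [intervalIntegrable_iff]
  refine (integrableOn_control_smul c hy).mono_set ?_
  exact uIoc_subset_uIcc.trans (uIcc_subset_Icc ha hb)

theorem intervalIntegrable_abs_control_mul {T : ℝ} (c : ScalarControl T) {h : ℝ → ℝ}
    (hh : ContinuousOn h (Icc 0 T)) {a b : ℝ} (ha : a ∈ Icc 0 T) (hb : b ∈ Icc 0 T) :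
    IntervalIntegrable (fun s => |c s| * h s) volume a b := by
  have h1 := (intervalIntegrable_control_smul c hh.abs ha hb).abs
  rw [intervalIntegrable_iff] at h1 ⊢
  refine h1.mono' ?_ ?_
  · have hsub : uIoc a b ⊆ Icc 0 T := uIoc_subset_uIcc.trans (uIcc_subset_Icc ha hb)
    have h2 : AEStronglyMeasurable (fun s => |c s|) (volume.restrict (uIoc a b)) :=
      ((Lp.aestronglyMeasurable c).mono_measure (Measure.restrict_mono hsub le_rfl)).norm
    exact h2.mul ((hh.mono hsub).aestronglyMeasurable measurableSet_uIoc)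
  · refine Eventually.of_forall fun s => ?_
    simp [abs_mul]

/-- The Cauchy-Schwarz inequality on a subinterval. -/
theorem integral_abs_control_mul_le {T : ℝ} (c : ScalarControl T) {h : ℝ → ℝ} {a b : ℝ}
    (ha : 0 ≤ a) (hab : a ≤ b) (hb : b ≤ T) (hh : ContinuousOn h (Icc a b))
    (h0 : ∀ s ∈ Icc a b, 0 ≤ h s) :
    ∫ s in a..b, |c s| * h s ≤ ‖c‖ * √(∫ s in a..b, h s ^ 2) := by
  have hsub : Ioc a b ⊆ Icc 0 T := fun s hs => ⟨ha.trans hs.1.le, hs.2.trans hb⟩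
  have hle : volume.restrict (Ioc a b) ≤ volume.restrict (Icc (0 : ℝ) T) :=
    Measure.restrict_mono hsub le_rfl
  have hc : MemLp (fun s => c s) 2 (volume.restrict (Ioc a b)) := (Lp.memLp c).mono_measure hle
  have hhm : MemLp h 2 (volume.restrict (Ioc a b)) := by
    obtain ⟨M, hM⟩ := (isCompact_Icc.image_of_continuousOn hh).isBounded.exists_norm_le
    refine MemLp.of_bound ((hh.mono Ioc_subset_Icc_self).aestronglyMeasurable measurableSet_Ioc)
      M ?_
    filter_upwards [ae_restrict_mem measurableSet_Ioc] with s hs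
    exact hM _ (mem_image_of_mem _ (Ioc_subset_Icc_self hs))
  have key := integral_mul_norm_le_Lp_mul_Lq (μ := volume.restrict (Ioc a b))
    (Real.HolderConjugate.two_two) (f := fun s => c s) (g := h) (by simpa using hc)
    (by simpa using hhm)
  have e1 : ∫ s in a..b, |c s| * h s = ∫ s in Ioc a b, ‖c s‖ * ‖h s‖ := by
    rw [intervalIntegral.integral_of_le hab]
    refine setIntegral_congr_fun measurableSet_Ioc fun s hs => ?_
    simp [abs_of_nonneg (h0 s (Ioc_subset_Icc_self hs))]
  rw [e1]
  refine key.trans ?_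
  rw [← Real.sqrt_eq_rpow, ← Real.sqrt_eq_rpow]
  refine mul_le_mul ?_ (le_of_eq ?_) (Real.sqrt_nonneg _) (norm_nonneg _)
  · refine Real.sqrt_le_iff.2 ⟨norm_nonneg _, ?_⟩
    have h2 : ‖c‖ ^ 2 = ∫ s in Icc 0 T, ‖c s‖ ^ (2 : ℝ) := by
      rw [← real_inner_self_eq_norm_sq, L2.inner_def]
      simp [sq]
    rw [h2]
    refine setIntegral_mono_set ?_ (Eventually.of_forall fun s => by positivity) hsub.eventuallyLE
    have := (Lp.memLp c).integrable_sq
    simpa [IntegrableOn] using this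
  · rw [intervalIntegral.integral_of_le hab]
    simp

/-- The factor `1 / √(2 * l)` gained over the exponential makes weighted estimates contract for
large `l`, on all of `[0,T]` at once. -/
theorem integral_abs_control_mul_exp_le {T : ℝ} (c : ScalarControl T) {l t : ℝ} (hl : 0 < l)
    (ht : t ∈ Icc 0 T) :
    ∫ s in (0 : ℝ)..t, |c s| * Real.exp (l * s) ≤ ‖c‖ * (Real.exp (l * t) / √(2 * l)) := by
  refine (integral_abs_control_mul_le c le_rfl ht.1 ht.2 (by fun_prop)
    fun s _ => (Real.exp_pos _).le).trans ?_
  refine mul_le_mul_of_nonneg_left ?_ (norm_nonneg _)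
  refine Real.sqrt_le_iff.2 ⟨by positivity, ?_⟩
  have : ∀ s : ℝ, Real.exp (l * s) ^ 2 = Real.exp ((2 * l) * s) := fun s => by
    rw [← Real.exp_nat_mul]; ring_nf
  simp_rw [this]
  rw [intervalIntegral.integral_comp_mul_left (fun s => Real.exp s) (by positivity), integral_exp, div_pow,
    Real.sq_sqrt (by positivity), this, smul_eq_mul, div_eq_inv_mul]
  refine mul_le_mul_of_nonneg_left ?_ (by positivity)
  have := Real.exp_pos (2 * l * 0)
  linarith

theorem norm_integral_control_smul_le_integral {T : ℝ} (c : ScalarControl T) {y : ℝ → Y}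
    {h : ℝ → ℝ} {a b : ℝ} (ha : 0 ≤ a) (hab : a ≤ b) (hb : b ≤ T) (hh : ContinuousOn h (Icc 0 T))
    (hyh : ∀ s ∈ Icc a b, ‖y s‖ ≤ h s) :
    ‖∫ s in a..b, c s • y s‖ ≤ ∫ s in a..b, |c s| * h s := by
  refine intervalIntegral.norm_integral_le_of_norm_le hab ?_
    (intervalIntegrable_abs_control_mul c hh ⟨ha, hab.trans hb⟩ ⟨ha.trans hab, hb⟩)
  refine Eventually.of_forall fun s hs => ?_
  rw [norm_smul, Real.norm_eq_abs]
  exact mul_le_mul_of_nonneg_left (hyh s (Ioc_subset_Icc_self hs)) (abs_nonneg _)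

theorem norm_integral_control_smul_le {T : ℝ} (c : ScalarControl T) {y : ℝ → Y} {M a b : ℝ}
    (ha : 0 ≤ a) (hab : a ≤ b) (hb : b ≤ T) (hM : ∀ s ∈ Icc a b, ‖y s‖ ≤ M) :
    ‖∫ s in a..b, c s • y s‖ ≤ ‖c‖ * (M * √(b - a)) := by
  have hM0 : 0 ≤ M := (norm_nonneg _).trans (hM a ⟨le_rfl, hab⟩)
  refine (norm_integral_control_smul_le_integral c ha hab hb (h := fun _ => M)
    continuousOn_const hM).trans ((integral_abs_control_mul_le c ha hab hb continuousOn_const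
      fun _ _ => hM0).trans ?_)
  refine mul_le_mul_of_nonneg_left ?_ (norm_nonneg _)
  rw [intervalIntegral.integral_const, smul_eq_mul, mul_comm, Real.sqrt_mul (by positivity),
    Real.sqrt_sq hM0]

/-- A Gronwall inequality with square-integrable coefficients. -/
theorem le_exp_of_le_add_integral {ι : Type*} [Fintype ι] {T : ℝ} (c : ι → ScalarControl T)
    {φ : ℝ → ℝ} (hφ : ContinuousOn φ (Icc 0 T)) (hφ0 : ∀ t ∈ Icc 0 T, 0 ≤ φ t) {K ε l : ℝ}
    (hK : 0 ≤ K) (hl : 0 < l) (hKl : K * ∑ i, ‖c i‖ ≤ √(2 * l) / 2)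
    (h : ∀ t ∈ Icc 0 T, φ t ≤ ε + K * ∑ i, ∫ s in (0 : ℝ)..t, |c i s| * φ s) :
    ∀ t ∈ Icc 0 T, φ t ≤ 2 * ε * Real.exp (l * t) := by
  intro t₀ ht₀
  have hT : (0 : ℝ) ≤ T := ht₀.1.trans ht₀.2
  -- At a maximum `m` of `exp (-l t) φ(t)` the hypothesis reads `m exp (l t) ≤ ε + m exp (l t) / 2`,
  -- whence `m ≤ 2 ε`.
  obtain ⟨t, ht, hmax⟩ := isCompact_Icc.exists_isMaxOn (nonempty_Icc.2 hT)
    (f := fun t => Real.exp (-(l * t)) * φ t) (by fun_prop)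
  obtain ⟨m, hm⟩ : ∃ m, m = Real.exp (-(l * t)) * φ t := ⟨_, rfl⟩
  have hm0 : 0 ≤ m := hm ▸ mul_nonneg (Real.exp_pos _).le (hφ0 t ht)
  have hle : ∀ s ∈ Icc 0 T, φ s ≤ m * Real.exp (l * s) := fun s hs => by
    have h1 : Real.exp (-(l * s)) * φ s ≤ m := hm ▸ hmax hs
    have h2 := mul_le_mul_of_nonneg_right h1 (Real.exp_pos (l * s)).le
    rwa [mul_right_comm, ← Real.exp_add, neg_add_cancel, Real.exp_zero, one_mul] at h2
  have hs2 : 0 < √(2 * l) := Real.sqrt_pos.2 (by positivity)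
  have hsum : K * ∑ i, ∫ s in (0 : ℝ)..t, |c i s| * φ s ≤ m * Real.exp (l * t) / 2 := by
    have h1 : ∀ i, ∫ s in (0 : ℝ)..t, |c i s| * φ s ≤
        ‖c i‖ * (m * (Real.exp (l * t) / √(2 * l))) := fun i => by
      calc ∫ s in (0 : ℝ)..t, |c i s| * φ s
          ≤ ∫ s in (0 : ℝ)..t, m * (|c i s| * Real.exp (l * s)) := by
            refine intervalIntegral.integral_mono_on ht.1
              (intervalIntegrable_abs_control_mul (c i) hφ ⟨le_rfl, hT⟩ ht)
              ((intervalIntegrable_abs_control_mul (c i) (by fun_prop) ⟨le_rfl, hT⟩ ht).const_mul m)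
              fun s hs => ?_
            have := hle s ⟨hs.1, hs.2.trans ht.2⟩
            calc |c i s| * φ s ≤ |c i s| * (m * Real.exp (l * s)) :=
                  mul_le_mul_of_nonneg_left this (abs_nonneg _)
              _ = _ := by ring
        _ = m * ∫ s in (0 : ℝ)..t, |c i s| * Real.exp (l * s) := by
            rw [intervalIntegral.integral_const_mul]
        _ ≤ m * (‖c i‖ * (Real.exp (l * t) / √(2 * l))) :=
            mul_le_mul_of_nonneg_left (integral_abs_control_mul_exp_le (c i) hl ht) hm0
        _ = _ := by ring
    calc K * ∑ i, ∫ s in (0 : ℝ)..t, |c i s| * φ s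
        ≤ K * ∑ i, ‖c i‖ * (m * (Real.exp (l * t) / √(2 * l))) :=
          mul_le_mul_of_nonneg_left (Finset.sum_le_sum fun i _ => h1 i) hK
      _ = (K * ∑ i, ‖c i‖) * (m * (Real.exp (l * t) / √(2 * l))) := by
          rw [← Finset.sum_mul, mul_assoc]
      _ ≤ √(2 * l) / 2 * (m * (Real.exp (l * t) / √(2 * l))) :=
          mul_le_mul_of_nonneg_right hKl (by positivity)
      _ = _ := by field_simp
  have h1 := h t ht
  have h2 : φ t = m * Real.exp (l * t) := by
    rw [hm, mul_right_comm, ← Real.exp_add, neg_add_cancel, Real.exp_zero, one_mul]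
  have h3 : m ≤ 2 * ε := by
    have h4 : 1 ≤ Real.exp (l * t) := Real.one_le_exp (mul_nonneg hl.le ht.1)
    by_contra hlt
    push Not at hlt
    nlinarith
  exact (hle t₀ ht₀).trans (mul_le_mul_of_nonneg_right h3 (Real.exp_pos _).le)

end Driftless
end

/-! ### Weak convergence of controls and comparison of trajectories -/

noncomputable section

/-- Bounded weak convergence along a filter. -/
def WeakTendsto {α H : Type*} [NormedAddCommGroup H] [NormedSpace ℝ H] (v : α → H) (l : Filter α)
    (v₀ : H) : Prop :=
  (∃ R, ∀ᶠ k in l, ‖v k‖ ≤ R) ∧ ∀ φ : H →L[ℝ] ℝ, Tendsto (fun k => φ (v k)) l (𝓝 (φ v₀))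

section WeakTendsto

variable {α H H' : Type*} [NormedAddCommGroup H] [NormedSpace ℝ H] [NormedAddCommGroup H']
  [NormedSpace ℝ H'] {l l' : Filter α} {v w : α → H} {v₀ w₀ : H}

theorem WeakTendsto.mono (h : WeakTendsto v l v₀) (hl : l' ≤ l) : WeakTendsto v l' v₀ :=
  ⟨h.1.imp fun _ hR => hR.filter_mono hl, fun φ => (h.2 φ).mono_left hl⟩

theorem WeakTendsto.clm_comp (h : WeakTendsto v l v₀) (A : H →L[ℝ] H') :
    WeakTendsto (fun k => A (v k)) l (A v₀) := by
  obtain ⟨⟨R, hR⟩, h2⟩ := h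
  refine ⟨⟨‖A‖ * R, hR.mono fun k hk => (A.le_opNorm _).trans ?_⟩, fun φ => h2 (φ.comp A)⟩
  exact mul_le_mul_of_nonneg_left hk (norm_nonneg _)

theorem WeakTendsto.add (h : WeakTendsto v l v₀) (h' : WeakTendsto w l w₀) :
    WeakTendsto (fun k => v k + w k) l (v₀ + w₀) := by
  obtain ⟨⟨R, hR⟩, h2⟩ := h
  obtain ⟨⟨R', hR'⟩, h2'⟩ := h'
  refine ⟨⟨R + R', ?_⟩, fun φ => by simpa using (h2 φ).add (h2' φ)⟩
  filter_upwards [hR, hR'] with k hk hk' using (norm_add_le _ _).trans (add_le_add hk hk')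

theorem Filter.Tendsto.weakTendsto (h : Tendsto v l (𝓝 v₀)) : WeakTendsto v l v₀ := by
  refine ⟨⟨‖v₀‖ + 1, ?_⟩, fun φ => (φ.continuous.tendsto _).comp h⟩
  exact (h.norm.eventually_lt_const (lt_add_one _)).mono fun _ hk => hk.le

/-- In a finite-dimensional target, weak convergence is convergence of finitely many coordinates,
hence norm convergence. -/
theorem WeakTendsto.tendsto_clm [FiniteDimensional ℝ H'] (h : WeakTendsto v l v₀)
    (A : H →L[ℝ] H') : Tendsto (fun k => A (v k)) l (𝓝 (A v₀)) := by
  let e := toEuclidean (E := H')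
  have h1 : Tendsto (fun k => e (A (v k))) l (𝓝 (e (A v₀))) := by
    have : Tendsto (fun k => (e (A (v k))).ofLp) l (𝓝 (e (A v₀)).ofLp) := by
      rw [tendsto_pi_nhds]
      intro i
      exact h.2 (((EuclideanSpace.proj i : _ →L[ℝ] ℝ).comp e.toContinuousLinearMap).comp A)
    exact ((PiLp.continuous_toLp 2 _).tendsto _).comp this
  simpa [Function.comp_def] using (e.symm.continuous.tendsto _).comp h1

end WeakTendsto

section Driftless

variable {Y : Type*} [NormedAddCommGroup Y] [NormedSpace ℝ Y]

theorem intervalIntegral_congr_ae_Icc {T : ℝ} {f g : ℝ → Y}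
    (h : f =ᵐ[volume.restrict (Icc (0 : ℝ) T)] g) {a b : ℝ} (ha : a ∈ Icc 0 T)
    (hb : b ∈ Icc 0 T) : ∫ s in a..b, f s = ∫ s in a..b, g s :=
  intervalIntegral.integral_congr_ae_restrict
    (ae_restrict_of_ae_restrict_of_subset (uIoc_subset_uIcc.trans (uIcc_subset_Icc ha hb)) h)

theorem integral_control_add_smul {T : ℝ} (c d : ScalarControl T) {y : ℝ → Y}
    (hy : ContinuousOn y (Icc 0 T)) {a b : ℝ} (ha : a ∈ Icc 0 T) (hb : b ∈ Icc 0 T) :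
    ∫ s in a..b, (c + d) s • y s = (∫ s in a..b, c s • y s) + ∫ s in a..b, d s • y s := by
  rw [← intervalIntegral.integral_add (intervalIntegrable_control_smul c hy ha hb)
    (intervalIntegrable_control_smul d hy ha hb)]
  refine intervalIntegral_congr_ae_Icc ?_ ha hb
  filter_upwards [Lp.coeFn_add c d] with s hs
  rw [hs, Pi.add_apply, add_smul]

theorem integral_control_smul_smul {T : ℝ} (r : ℝ) (c : ScalarControl T) (y : ℝ → Y)
    {a b : ℝ} (ha : a ∈ Icc 0 T) (hb : b ∈ Icc 0 T) :
    ∫ s in a..b, (r • c) s • y s = r • ∫ s in a..b, c s • y s := by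
  rw [← intervalIntegral.integral_smul]
  refine intervalIntegral_congr_ae_Icc ?_ ha hb
  filter_upwards [Lp.coeFn_smul r c] with s hs
  rw [hs, Pi.smul_apply, smul_eq_mul, mul_smul]

theorem integral_control_sub_smul {T : ℝ} (c d : ScalarControl T) {y : ℝ → Y}
    (hy : ContinuousOn y (Icc 0 T)) {a b : ℝ} (ha : a ∈ Icc 0 T) (hb : b ∈ Icc 0 T) :
    ∫ s in a..b, (c - d) s • y s = (∫ s in a..b, c s • y s) - ∫ s in a..b, d s • y s := by
  rw [eq_sub_iff_add_eq, ← integral_control_add_smul _ _ hy ha hb, sub_add_cancel]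

/-- Cauchy-Schwarz on `[s,t]` gives the modulus `M √|t - s|` uniformly over unit controls. This norm
continuity in `t` is what upgrades weak convergence to uniformity in time. -/
theorem exists_primitive_clm {T : ℝ} (hT : 0 ≤ T) {y : ℝ → Y} (hy : ContinuousOn y (Icc 0 T)) :
    ∃ J : ℝ → (ScalarControl T →L[ℝ] Y), ContinuousOn J (Icc 0 T) ∧
      ∀ t ∈ Icc 0 T, ∀ c, J t c = ∫ s in (0 : ℝ)..t, c s • y s := by
  obtain ⟨M, hM⟩ := (isCompact_Icc.image_of_continuousOn hy).isBounded.exists_norm_le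
  replace hM : ∀ s ∈ Icc 0 T, ‖y s‖ ≤ M := fun s hs => hM _ (mem_image_of_mem _ hs)
  have h0 : (0 : ℝ) ∈ Icc 0 T := ⟨le_rfl, hT⟩
  have hM0 : 0 ≤ M := (norm_nonneg _).trans (hM 0 h0)
  have hb : ∀ t : Icc 0 T, ∃ J : ScalarControl T →L[ℝ] Y,
      ∀ c, J c = ∫ s in (0 : ℝ)..t, c s • y s := fun t => by
    refine ⟨LinearMap.mkContinuous ⟨⟨fun c => ∫ s in (0 : ℝ)..t, c s • y s, fun c d =>
      integral_control_add_smul c d hy h0 t.2⟩, fun r c =>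
      integral_control_smul_smul r c y h0 t.2⟩ (M * √(t - 0)) fun c => ?_, fun c => rfl⟩
    rw [mul_comm]
    exact norm_integral_control_smul_le c le_rfl t.2.1 t.2.2 fun s hs =>
      hM s ⟨hs.1, hs.2.trans t.2.2⟩
  choose J hJ using hb
  refine ⟨fun t => J (projIcc 0 T hT t), ?_, fun t ht c => by rw [hJ, projIcc_of_mem hT ht]⟩
  have hle : ∀ s t, s ∈ Icc 0 T → t ∈ Icc 0 T → s ≤ t →
      ‖J (projIcc 0 T hT t) - J (projIcc 0 T hT s)‖ ≤ M * √(t - s) := fun s t hs ht hst => by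
    refine ContinuousLinearMap.opNorm_le_bound _ (by positivity) fun c => ?_
    rw [sub_apply, hJ, hJ, projIcc_of_mem hT ht, projIcc_of_mem hT hs,
      intervalIntegral.integral_interval_sub_left
        (intervalIntegrable_control_smul c hy h0 ht) (intervalIntegrable_control_smul c hy h0 hs),
      mul_comm]
    exact norm_integral_control_smul_le c hs.1 hst ht.2 fun r hr =>
      hM r ⟨hs.1.trans hr.1, hr.2.trans ht.2⟩
  have hle' : ∀ s ∈ Icc 0 T, ∀ t ∈ Icc 0 T,
      ‖J (projIcc 0 T hT t) - J (projIcc 0 T hT s)‖ ≤ M * √|t - s| := fun s hs t ht => by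
    rcases le_total s t with h | h
    · rw [abs_of_nonneg (sub_nonneg.2 h)]; exact hle s t hs ht h
    · rw [abs_sub_comm, abs_of_nonneg (sub_nonneg.2 h), norm_sub_rev]; exact hle t s ht hs h
  intro s hs
  rw [ContinuousWithinAt, tendsto_iff_norm_sub_tendsto_zero]
  refine squeeze_zero' (Eventually.of_forall fun _ => norm_nonneg _)
    (eventually_nhdsWithin_of_forall fun t ht => hle' s hs t ht) ?_
  have : Continuous fun t => M * √|t - s| := by fun_prop
  simpa using (this.tendsto s).mono_left nhdsWithin_le_nhds

/-- At a fixed time the primitive is a bounded operator, so it tends to zero under weak convergence.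
Uniformity follows by taking a limit time `t₀` of bad times and comparing `J (t k)` with `J t₀` in
operator norm. -/
theorem WeakTendsto.eventually_norm_integral_le [FiniteDimensional ℝ Y] {T : ℝ} (hT : 0 ≤ T)
    {y : ℝ → Y}
    (hy : ContinuousOn y (Icc 0 T)) {α : Type*} {l : Filter α} {c' : α → ScalarControl T}
    {c : ScalarControl T} (hc : WeakTendsto c' l c) {ε : ℝ} (hε : 0 < ε) :
    ∀ᶠ k in l, ∀ t ∈ Icc 0 T, ‖∫ s in (0 : ℝ)..t, (c' k - c) s • y s‖ ≤ ε := by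
  obtain ⟨J, hJc, hJ⟩ := exists_primitive_clm hT hy
  obtain ⟨R, hR⟩ := (by simpa using hc.add (tendsto_const_nhds (x := -c)).weakTendsto :
    WeakTendsto (fun k => c' k + -c) l 0).1
  refine mem_iff_ultrafilter.2 fun g hg => ?_
  by_contra hbad
  rw [← Ultrafilter.compl_mem_iff_notMem] at hbad
  have hbad' : ∀ᶠ k in (g : Filter α), ∃ t ∈ Icc 0 T, ε < ‖J t (c' k - c)‖ := by
    filter_upwards [hbad] with k hk
    simp only [mem_compl_iff, mem_ofPred_eq, not_forall, not_le] at hk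
    obtain ⟨t, ht, h⟩ := hk
    exact ⟨t, ht, by rwa [hJ t ht]⟩
  have : ∃ t : α → ℝ, ∀ᶠ k in (g : Filter α), t k ∈ Icc 0 T ∧ ε < ‖J (t k) (c' k - c)‖ := by
    choose! t ht using fun k (h : ∃ t ∈ Icc 0 T, ε < ‖J t (c' k - c)‖) => h
    exact ⟨t, hbad'.mono ht⟩
  obtain ⟨t, ht⟩ := this
  obtain ⟨t₀, ht₀, hlim⟩ := isCompact_Icc.ultrafilter_le_nhds (g.map t)
    (le_principal_iff.2 (ht.mono fun k hk => hk.1))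
  have hlim' : Tendsto t g (𝓝[Icc 0 T] t₀) :=
    tendsto_nhdsWithin_iff.2 ⟨hlim, ht.mono fun k hk => hk.1⟩
  have h1 : Tendsto (fun k => J t₀ (c' k - c)) g (𝓝 0) := by
    have := (hc.mono hg).tendsto_clm (J t₀)
    simpa using this.sub_const (J t₀ c)
  have h2 : Tendsto (fun k => ‖J (t k) - J t₀‖ * R) g (𝓝 0) := by
    have := ((hJc t₀ ht₀).tendsto.comp hlim').sub_const (J t₀)
    simpa using this.norm.mul_const R
  have h3 : Tendsto (fun k => ‖J (t k) - J t₀‖ * R + ‖J t₀ (c' k - c)‖) g (𝓝 0) := by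
    simpa using h2.add h1.norm
  obtain ⟨k, hk1, hk2, hk3⟩ := ((h3.eventually_lt_const hε).and (ht.and (hR.filter_mono hg))).exists
  refine absurd hk1 (not_lt.2 (hk2.2.le.trans ?_))
  have : J (t k) (c' k - c) = (J (t k) - J t₀) (c' k - c) + J t₀ (c' k - c) := by simp
  rw [this]
  refine (norm_add_le _ _).trans (add_le_add ((ContinuousLinearMap.le_opNorm _ _).trans ?_) le_rfl)
  exact mul_le_mul_of_nonneg_left (by rwa [sub_eq_add_neg]) (norm_nonneg _)

/-- `x` solves `ẋ = ∑ cᵢ gᵢ(x)`, `x(0) = a` on `[0,T]`. -/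
def IsSol {ι : Type*} [Fintype ι] (T : ℝ) (g : ι → Y → Y) (a : Y) (c : ι → ScalarControl T)
    (x : ℝ → Y) : Prop :=
  ContinuousOn x (Icc 0 T) ∧
  ∀ t ∈ Icc (0 : ℝ) T, x t = a + ∑ i, ∫ s in (0 : ℝ)..t, c i s • g i (x s)

variable {ι : Type*} [Fintype ι] {T : ℝ} {g : ι → Y → Y} {a a' : Y} {c c' : ι → ScalarControl T}
  {x x' : ℝ → Y}

/-- The difference of the controls is integrated only along the fixed trajectory `x`, so a weakly
small difference already makes `δ` small. The remaining term is Lipschitz in `x' - x` and is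
absorbed by Gronwall. -/
theorem IsSol.norm_sub_le (hg : ∀ i, Continuous (g i)) (hx : IsSol T g a c x)
    (hx' : IsSol T g a' c' x') {K δ l : ℝ} (hK : 0 ≤ K)
    (hL : ∀ i, ∀ s ∈ Icc 0 T, ‖g i (x' s) - g i (x s)‖ ≤ K * ‖x' s - x s‖)
    (hδ : ∀ t ∈ Icc 0 T, ∀ i, ‖∫ s in (0 : ℝ)..t, (c' i - c i) s • g i (x s)‖ ≤ δ)
    (hl : 0 < l) (hKl : K * ∑ i, ‖c' i‖ ≤ √(2 * l) / 2) :
    ∀ t ∈ Icc 0 T,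
      ‖x' t - x t‖ ≤ 2 * (‖a' - a‖ + Fintype.card ι * δ) * Real.exp (l * t) := by
  have hcx : ContinuousOn (fun t => ‖x' t - x t‖) (Icc 0 T) := (hx'.1.sub hx.1).norm
  refine le_exp_of_le_add_integral c' hcx (fun _ _ => norm_nonneg _) hK hl hKl fun t ht => ?_
  have h0 : (0 : ℝ) ∈ Icc 0 T := ⟨le_rfl, ht.1.trans ht.2⟩
  have hgx : ∀ i, ContinuousOn (fun s => g i (x s)) (Icc 0 T) := fun i =>
    (hg i).comp_continuousOn hx.1
  have hgx' : ∀ i, ContinuousOn (fun s => g i (x' s)) (Icc 0 T) := fun i =>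
    (hg i).comp_continuousOn hx'.1
  have hdec : x' t - x t = (a' - a) + ((∑ i, ∫ s in (0 : ℝ)..t, (c' i - c i) s • g i (x s)) +
      ∑ i, ∫ s in (0 : ℝ)..t, c' i s • (g i (x' s) - g i (x s))) := by
    rw [hx'.2 t ht, hx.2 t ht, ← Finset.sum_add_distrib, add_sub_add_comm,
      ← Finset.sum_sub_distrib]
    congr 1
    refine Finset.sum_congr rfl fun i _ => ?_
    simp_rw [smul_sub]
    rw [integral_control_sub_smul _ _ (hgx i) h0 ht, intervalIntegral.integral_sub
      (intervalIntegrable_control_smul _ (hgx' i) h0 ht)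
      (intervalIntegrable_control_smul _ (hgx i) h0 ht)]
    abel
  rw [hdec, add_assoc]
  refine (norm_add_le _ _).trans (add_le_add le_rfl ((norm_add_le _ _).trans (add_le_add ?_ ?_)))
  · refine (norm_sum_le_of_le _ fun i _ => hδ t ht i).trans ?_
    simp
  · rw [Finset.mul_sum]
    refine norm_sum_le_of_le _ fun i _ => ?_
    refine (norm_integral_control_smul_le_integral (c' i) le_rfl ht.1 ht.2
      (continuousOn_const.mul hcx) (h := fun s => K * ‖x' s - x s‖)
      fun s hs => hL i s ⟨hs.1, hs.2.trans ht.2⟩).trans (le_of_eq ?_)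
    rw [← intervalIntegral.integral_const_mul]
    refine intervalIntegral.integral_congr fun s _ => ?_
    ring

end Driftless
end

/-! ### Existence, uniqueness and persistence of trajectories -/

noncomputable section
section Driftless

variable {Y : Type*} [NormedAddCommGroup Y] [NormedSpace ℝ Y]
variable {ι : Type*} [Fintype ι] {T : ℝ} {g : ι → Y → Y} {a a' : Y} {c c' : ι → ScalarControl T}
  {x x' : ℝ → Y}

theorem exists_rate (K S : ℝ) : ∃ l : ℝ, 0 < l ∧ K * S ≤ √(2 * l) / 2 := by
  -- Chosen so that `2 l ≥ (2 K S)²` with `l > 0`.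
  refine ⟨2 * (K * S) ^ 2 + 1, by positivity, ?_⟩
  have : √((2 * (K * S)) ^ 2) ≤ √(2 * (2 * (K * S) ^ 2 + 1)) :=
    Real.sqrt_le_sqrt (by nlinarith)
  rw [Real.sqrt_sq_eq_abs] at this
  have := le_abs_self (2 * (K * S))
  linarith

theorem LocallyLipschitz.exists_bound [FiniteDimensional ℝ Y] (hg : ∀ i, LocallyLipschitz (g i))
    (R : ℝ) : ∃ K : NNReal, ∀ i, LipschitzOnWith K (g i) (Metric.closedBall 0 R) := by
  have : ProperSpace Y := FiniteDimensional.proper ℝ Y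
  have := fun i => ((hg i).locallyLipschitzOn (s := Metric.closedBall 0 R)).exists_lipschitzOnWith_of_compact
    (isCompact_closedBall 0 R)
  choose K hK using this
  exact ⟨∑ i, K i, fun i => (hK i).weaken (Finset.single_le_sum (f := K) (fun _ _ => zero_le) (Finset.mem_univ i))⟩

theorem IsSol.exists_bound (hx : IsSol T g a c x) : ∃ R, ∀ t ∈ Icc 0 T, ‖x t‖ ≤ R := by
  obtain ⟨M, hM⟩ := (isCompact_Icc.image_of_continuousOn hx.1).isBounded.exists_norm_le
  exact ⟨M, fun s hs => hM _ (mem_image_of_mem _ hs)⟩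

theorem IsSol.unique [FiniteDimensional ℝ Y] (hg : ∀ i, LocallyLipschitz (g i))
    (hx : IsSol T g a c x) (hx' : IsSol T g a c x') : EqOn x x' (Icc 0 T) := by
  obtain ⟨R, hR⟩ := hx.exists_bound
  obtain ⟨R', hR'⟩ := hx'.exists_bound
  obtain ⟨K, hK⟩ := LocallyLipschitz.exists_bound hg (max R R')
  obtain ⟨l, hl, hKl⟩ := exists_rate K (∑ i, ‖c i‖)
  intro t ht
  have h := hx.norm_sub_le (fun i => (hg i).continuous) hx' (δ := 0) K.2 (fun i s hs =>
    (hK i).norm_sub_le (by simpa using Or.inr (hR' s hs)) (by simpa using Or.inl (hR s hs)))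
    (fun t ht i => by
      rw [integral_control_sub_smul (y := fun s => g i (x s)) _ _ ((hg i).continuous.comp_continuousOn hx.1)
        ⟨le_rfl, ht.1.trans ht.2⟩ ht, sub_self, norm_zero]) hl hKl t ht
  simp only [sub_self, norm_zero, mul_zero, add_zero, zero_mul, norm_le_zero_iff] at h
  exact (sub_eq_zero.1 h).symm

theorem IsSol.congr {g' : ι → Y → Y} (hx : IsSol T g a c x)
    (h : ∀ i, ∀ t ∈ Icc 0 T, g i (x t) = g' i (x t)) : IsSol T g' a c x := by
  refine ⟨hx.1, fun t ht => ?_⟩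
  rw [hx.2 t ht]
  congr 1
  refine Finset.sum_congr rfl fun i _ => intervalIntegral.integral_congr fun s hs => ?_
  rw [uIcc_of_le ht.1] at hs
  simp only [h i s ⟨hs.1, hs.2.trans ht.2⟩]

/-- Picard iteration for the rescaled unknown `z(t) = exp (-l t) x(t)`: in the sup norm it contracts
by `1/2` on the whole interval, so no gluing of short-time solutions is needed. -/
theorem exists_isSol_of_lipschitzWith [CompleteSpace Y] (hT : 0 ≤ T) {K : NNReal}
    (hg : ∀ i, LipschitzWith K (g i)) (a : Y) (c : ι → ScalarControl T) :
    ∃ x, IsSol T g a c x := by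
  obtain ⟨l, hl, hKl⟩ := exists_rate K (∑ i, ‖c i‖)
  have h0 : (0 : ℝ) ∈ Icc 0 T := ⟨le_rfl, hT⟩
  let ext : C(Icc 0 T, Y) → ℝ → Y := fun z s => Real.exp (l * s) • z (projIcc 0 T hT s)
  have hext : ∀ z, Continuous (ext z) := fun z => by
    simp only [ext]
    have := z.continuous.comp (continuous_projIcc (h := hT))
    exact (by fun_prop : Continuous fun s => Real.exp (l * s)).smul this
  have hgext : ∀ i z, ContinuousOn (fun s => g i (ext z s)) (Icc 0 T) := fun i z =>
    ((hg i).continuous.comp (hext z)).continuousOn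
  have hint : ∀ z i, ContinuousOn (fun t => ∫ s in (0 : ℝ)..t, c i s • g i (ext z s))
      (Icc 0 T) := fun z i => by
    have := intervalIntegral.continuousOn_primitive_interval (μ := volume) (a := 0) (b := T)
      (f := fun s => c i s • g i (ext z s)) (by
        rw [uIcc_of_le hT]; exact integrableOn_control_smul (c i) (hgext i z))
    rwa [uIcc_of_le hT] at this
  let F : C(Icc 0 T, Y) → ℝ → Y := fun z t =>
    a + ∑ i, ∫ s in (0 : ℝ)..t, c i s • g i (ext z s)
  have hF : ∀ z, ContinuousOn (F z) (Icc 0 T) := fun z =>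
    continuousOn_const.add (continuousOn_finsetSum _ fun i _ => hint z i)
  let P : C(Icc 0 T, Y) → C(Icc 0 T, Y) := fun z =>
    ⟨fun t => Real.exp (-(l * t)) • F z t, by
      have h1 : Continuous fun t : Icc 0 T => F z t := continuousOn_iff_continuous_domRestrict.1 (hF z)
      have h2 : Continuous fun t : Icc 0 T => Real.exp (-(l * (t : ℝ))) := by fun_prop
      exact h2.smul h1⟩
  have hP : ContractingWith (1 / 2) P := by
    refine ⟨by norm_num, LipschitzWith.of_dist_le_mul fun z z' => ?_⟩
    rw [ContinuousMap.dist_le (by positivity)]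
    rintro ⟨t, ht⟩
    have hdiff : ∀ s, ‖ext z s - ext z' s‖ ≤ Real.exp (l * s) * dist z z' := fun s => by
      simp only [ext]
      rw [← smul_sub, norm_smul, Real.norm_eq_abs, abs_of_pos (Real.exp_pos _), ← dist_eq_norm]
      exact mul_le_mul_of_nonneg_left (ContinuousMap.dist_apply_le_dist _) (Real.exp_pos _).le
    have hFd : ‖F z t - F z' t‖ ≤ Real.exp (l * t) * (1 / 2 * dist z z') := by
      simp only [F]
      rw [add_sub_add_left_eq_sub, ← Finset.sum_sub_distrib]
      have h1 : ∀ i, ‖(∫ s in (0 : ℝ)..t, c i s • g i (ext z s)) -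
          ∫ s in (0 : ℝ)..t, c i s • g i (ext z' s)‖ ≤
          ‖c i‖ * (K * dist z z' * (Real.exp (l * t) / √(2 * l))) := fun i => by
        rw [← intervalIntegral.integral_sub (intervalIntegrable_control_smul _ (hgext i z) h0 ht)
          (intervalIntegrable_control_smul _ (hgext i z') h0 ht)]
        simp_rw [← smul_sub]
        refine (norm_integral_control_smul_le_integral (c i) le_rfl ht.1 ht.2
          (h := fun s => K * dist z z' * Real.exp (l * s)) (by fun_prop) fun s _ => ?_).trans ?_
        · refine ((hg i).norm_sub_le _ _).trans ?_
          calc (K : ℝ) * ‖ext z s - ext z' s‖ ≤ K * (Real.exp (l * s) * dist z z') :=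
                mul_le_mul_of_nonneg_left (hdiff s) K.2
            _ = _ := by ring
        · have : ∀ s, |c i s| * (K * dist z z' * Real.exp (l * s)) =
              K * dist z z' * (|c i s| * Real.exp (l * s)) := fun s => by ring
          simp_rw [this]
          rw [intervalIntegral.integral_const_mul, mul_left_comm]
          exact mul_le_mul_of_nonneg_left (integral_abs_control_mul_exp_le (c i) hl ht)
            (by positivity)
      refine (norm_sum_le_of_le _ fun i _ => h1 i).trans ?_
      rw [← Finset.sum_mul]
      have hs : 0 < √(2 * l) := Real.sqrt_pos.2 (by positivity)
      calc (∑ i, ‖c i‖) * (K * dist z z' * (Real.exp (l * t) / √(2 * l)))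
          = (K * ∑ i, ‖c i‖) * (dist z z' * (Real.exp (l * t) / √(2 * l))) := by ring
        _ ≤ √(2 * l) / 2 * (dist z z' * (Real.exp (l * t) / √(2 * l))) :=
            mul_le_mul_of_nonneg_right hKl (by positivity)
        _ = _ := by field_simp
    change dist (Real.exp (-(l * t)) • F z t) (Real.exp (-(l * t)) • F z' t) ≤ _
    rw [dist_eq_norm, ← smul_sub, norm_smul, Real.norm_eq_abs, abs_of_pos (Real.exp_pos _)]
    calc Real.exp (-(l * t)) * ‖F z t - F z' t‖
        ≤ Real.exp (-(l * t)) * (Real.exp (l * t) * (1 / 2 * dist z z')) :=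
          mul_le_mul_of_nonneg_left hFd (Real.exp_pos _).le
      _ = _ := by
        rw [← mul_assoc, ← Real.exp_add, neg_add_cancel, Real.exp_zero, one_mul]
        simp
  have : Nonempty C(Icc 0 T, Y) := ⟨0⟩
  obtain ⟨z, hz⟩ : ∃ z, P z = z := ⟨_, hP.fixedPoint_isFixedPt⟩
  refine ⟨ext z, (hext z).continuousOn, fun t ht => ?_⟩
  have h1 : z ⟨t, ht⟩ = Real.exp (-(l * t)) • F z t := by
    conv_lhs => rw [← hz]
    rfl
  have h2 : ext z t = Real.exp (l * t) • z ⟨t, ht⟩ := by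
    simp only [ext, projIcc_of_mem hT ht]
  rw [h2, h1, smul_smul, ← Real.exp_add, add_neg_cancel, Real.exp_zero, one_smul]

/-- Solutions persist, and depend continuously on the initial point and weakly continuously on
the controls. -/
theorem IsSol.eventually_exists [FiniteDimensional ℝ Y] (hT : 0 ≤ T)
    (hg : ∀ i, LocallyLipschitz (g i)) (hx : IsSol T g a c x) {α : Type*} {l : Filter α}
    {c' : α → ι → ScalarControl T} {a' : α → Y} (ha : Tendsto a' l (𝓝 a))
    (hc : ∀ i, WeakTendsto (fun k => c' k i) l (c i)) :
    ∃ x' : α → ℝ → Y, (∀ᶠ k in l, IsSol T g (a' k) (c' k) (x' k)) ∧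
      Tendsto (fun k => x' k T) l (𝓝 (x T)) := by
  have : CompleteSpace Y := FiniteDimensional.complete ℝ Y
  obtain ⟨R, hR⟩ := hx.exists_bound
  obtain ⟨K, hK⟩ := LocallyLipschitz.exists_bound hg (R + 1)
  -- Cut-off: the `g' i` are globally Lipschitz and agree with the `g i` on the ball of radius `R +
  -- 1`. Their solutions exist on all of `[0,T]`, and once uniformly within `1` of `x` they solve
  -- the original system.
  choose g' hg' hgg' using fun i => (hK i).extend_finite_dimension
  have hxg' : IsSol T g' a c x := hx.congr fun i t ht =>
    hgg' i (by simpa using (hR t ht).trans (by linarith))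
  choose x' hx' using fun k => exists_isSol_of_lipschitzWith hT hg' (a' k) (c' k)
  choose S hS using fun i => (hc i).1
  set K' := lipschitzExtensionConstant Y * K
  obtain ⟨r, hr, hKr⟩ := exists_rate K' (∑ i, S i)
  have huni : ∀ ε > 0, ∀ᶠ k in l, ∀ t ∈ Icc 0 T, ‖x' k t - x t‖ ≤ ε := by
    intro ε hε
    -- `B` bounds the amplification factor of `IsSol.norm_sub_le`, so errors `ε / B` in the data
    -- produce at most `ε`.
    set B := 2 * (1 + Fintype.card ι) * Real.exp (r * T)
    have hB : 0 < B := by positivity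
    have h1 : ∀ᶠ k in l, ‖a' k - a‖ < ε / B := by
      have := (tendsto_iff_norm_sub_tendsto_zero.1 ha)
      exact this.eventually_lt_const (by positivity)
    have h2 := eventually_all.2 fun i => (hc i).eventually_norm_integral_le hT
      ((hg' i).continuous.comp_continuousOn hx.1) (ε := ε / B) (by positivity)
    have h3 := eventually_all.2 hS
    filter_upwards [h1, h2, h3] with k hk1 hk2 hk3 t ht
    refine (hxg'.norm_sub_le (fun i => (hg' i).continuous) (hx' k) (δ := ε / B) K'.2
      (fun i s _ => (hg' i).norm_sub_le _ _) (fun t ht i => hk2 i t ht) hr ?_ t ht).trans ?_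
    · exact (mul_le_mul_of_nonneg_left (Finset.sum_le_sum fun i _ => hk3 i) K'.2).trans hKr
    · calc 2 * (‖a' k - a‖ + Fintype.card ι * (ε / B)) * Real.exp (r * t)
          ≤ 2 * (ε / B + Fintype.card ι * (ε / B)) * Real.exp (r * T) := by
            gcongr
            exact ht.2
        _ = B * (ε / B) := by simp only [B]; ring
        _ = ε := by field_simp
  refine ⟨x', ?_, ?_⟩
  · filter_upwards [huni 1 one_pos] with k hk
    refine (hx' k).congr fun i t ht => (hgg' i ?_).symm
    rw [mem_closedBall_zero_iff]
    have := norm_le_norm_add_norm_sub' (x' k t) (x t)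
    linarith [hR t ht, hk t ht]
  · rw [tendsto_iff_norm_sub_tendsto_zero, Metric.tendsto_nhds]
    intro ε hε
    filter_upwards [huni (ε / 2) (by positivity)] with k hk
    rw [Real.dist_eq, sub_zero, abs_norm]
    linarith [hk T ⟨hT, le_rfl⟩]

end Driftless
end

/-! ### Divided differences and the variational equation -/

noncomputable section
section Variation

variable {X Y Z : Type*} [NormedAddCommGroup Y] [NormedSpace ℝ Y] [NormedAddCommGroup Z]
  [NormedSpace ℝ Z] [NormedAddCommGroup X] [NormedSpace ℝ X]
variable {ι : Type*} {T : ℝ}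

theorem clm_integral_control_smul [CompleteSpace Y] [CompleteSpace Z] (A : Y →L[ℝ] Z)
    (c : ScalarControl T) {y : ℝ → Y}
    (hy : ContinuousOn y (Icc 0 T)) {a b : ℝ} (ha : a ∈ Icc 0 T) (hb : b ∈ Icc 0 T) :
    A (∫ s in a..b, c s • y s) = ∫ s in a..b, c s • A (y s) := by
  rw [← A.intervalIntegral_comp_comm (intervalIntegrable_control_smul c hy ha hb)]
  simp only [map_smul]

theorem clm_sum_integral_control_smul [Fintype ι] [CompleteSpace Y] [CompleteSpace Z] (A : Y →L[ℝ] Z)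
    (c : ι → ScalarControl T) {y : ι → ℝ → Y} (hy : ∀ i, ContinuousOn (y i) (Icc 0 T)) {a b : ℝ}
    (ha : a ∈ Icc 0 T) (hb : b ∈ Icc 0 T) :
    A (∑ i, ∫ s in a..b, c i s • y i s) = ∑ i, ∫ s in a..b, c i s • A (y i s) := by
  rw [map_sum]
  exact Finset.sum_congr rfl fun i _ => clm_integral_control_smul A _ (hy i) ha hb

theorem IsSol.map [Fintype ι] [CompleteSpace Y] [CompleteSpace Z] {g : ι → Y → Y} {h : ι → Z → Z} {a : Y}
    {c : ι → ScalarControl T} {x : ℝ → Y} (hg : ∀ i, Continuous (g i)) (hx : IsSol T g a c x)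
    (A : Y →L[ℝ] Z) (hA : ∀ i, ∀ t ∈ Icc 0 T, A (g i (x t)) = h i (A (x t))) :
    IsSol T h (A a) c (fun t => A (x t)) := by
  refine ⟨A.continuous.comp_continuousOn hx.1, fun t ht => ?_⟩
  beta_reduce
  rw [hx.2 t ht, map_add, map_sum]
  congr 1
  refine Finset.sum_congr rfl fun i _ => ?_
  rw [clm_integral_control_smul (y := fun s => g i (x s)) A (c i) ((hg i).comp_continuousOn hx.1)
    ⟨le_rfl, ht.1.trans ht.2⟩ ht]
  refine intervalIntegral.integral_congr fun s hs => ?_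
  rw [uIcc_of_le ht.1] at hs
  simp only [hA i s ⟨hs.1, hs.2.trans ht.2⟩]

theorem IsSol.combine [Fintype ι] {f : ι → X → X} (hf : ∀ i, Continuous (f i)) {a : X} {r : ℝ}
    {e : ι ⊕ ι → ScalarControl T} {x : ℝ → X}
    (hx : IsSol T (Sum.elim f (fun i z => r • f i z)) a e x) :
    IsSol T f a (fun i => e (Sum.inl i) + r • e (Sum.inr i)) x := by
  refine ⟨hx.1, fun t ht => ?_⟩
  have h0 : (0 : ℝ) ∈ Icc 0 T := ⟨le_rfl, ht.1.trans ht.2⟩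
  rw [hx.2 t ht, Fintype.sum_sum_type, ← Finset.sum_add_distrib]
  congr 1
  refine Finset.sum_congr rfl fun i _ => ?_
  rw [integral_control_add_smul (y := fun s => f i (x s)) _ _ ((hf i).comp_continuousOn hx.1) h0 ht,
    integral_control_smul_smul r _ _ h0 ht, ← intervalIntegral.integral_smul]
  congr 1
  exact intervalIntegral.integral_congr fun s _ => smul_comm _ _ _

theorem locallyLipschitz_intervalIntegral [FiniteDimensional ℝ Y] {h : Y × ℝ → X}
    (hh : ContDiff ℝ 1 h) : LocallyLipschitz fun z => ∫ s in (0 : ℝ)..1, h (z, s) := by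
  have : ProperSpace Y := FiniteDimensional.proper ℝ Y
  intro z
  obtain ⟨K, hK⟩ := (hh.locallyLipschitz.locallyLipschitzOn
    (s := Metric.closedBall z 1 ×ˢ Icc (0 : ℝ) 1)).exists_lipschitzOnWith_of_compact
    ((isCompact_closedBall z 1).prod isCompact_Icc)
  refine ⟨K, Metric.closedBall z 1, Metric.closedBall_mem_nhds z one_pos,
    LipschitzOnWith.of_dist_le_mul fun z₁ h₁ z₂ h₂ => ?_⟩
  have hi : ∀ z, IntervalIntegrable (fun s => h (z, s)) volume 0 1 := fun z =>
    (hh.continuous.comp (by fun_prop : Continuous fun s : ℝ => (z, s))).intervalIntegrable _ _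
  rw [dist_eq_norm, ← intervalIntegral.integral_sub (hi _) (hi _)]
  refine (intervalIntegral.norm_integral_le_of_norm_le_const (C := K * dist z₁ z₂)
    fun s hs => ?_).trans (by simp)
  rw [uIoc_of_le zero_le_one] at hs
  have hs' := Ioc_subset_Icc_self hs
  refine (hK.norm_sub_le (mk_mem_prod h₁ hs') (mk_mem_prod h₂ hs')).trans (le_of_eq ?_)
  rw [← dist_eq_norm, Prod.dist_eq]
  simp

/-- The divided difference of `f` at `x` and `x + λ y`, divided by `λ`. -/
def dividedDifference (f : X → X) (z : X × X × ℝ) : X :=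
  ∫ s in (0 : ℝ)..1, fderiv ℝ f (z.1 + (s * z.2.2) • z.2.1) z.2.1

theorem locallyLipschitz_dividedDifference [FiniteDimensional ℝ X] {f : X → X}
    (hf : ContDiff ℝ 2 f) : LocallyLipschitz (dividedDifference f) := by
  refine locallyLipschitz_intervalIntegral (h := fun p : (X × X × ℝ) × ℝ =>
    fderiv ℝ f (p.1.1 + (p.2 * p.1.2.2) • p.1.2.1) p.1.2.1) ?_
  have h1 : ContDiff ℝ 1 (fderiv ℝ f) := hf.fderiv_right (by norm_num)
  exact (h1.comp (by fun_prop : ContDiff ℝ 1 fun p : (X × X × ℝ) × ℝ =>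
    p.1.1 + (p.2 * p.1.2.2) • p.1.2.1)).clm_apply (by fun_prop)

theorem dividedDifference_zero [CompleteSpace X] (f : X → X) (x y : X) :
    dividedDifference f (x, y, 0) = fderiv ℝ f x y := by
  simp [dividedDifference]

theorem smul_dividedDifference [CompleteSpace X] {f : X → X} (hf : ContDiff ℝ 2 f) (x y : X)
    (r : ℝ) : r • dividedDifference f (x, y, r) = f (x + r • y) - f x := by
  have hc : Continuous (fderiv ℝ f) := hf.continuous_fderiv (by norm_num)
  have hd : ∀ s ∈ uIcc (0 : ℝ) 1, HasDerivAt (fun s : ℝ => f (x + (s * r) • y))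
      (r • fderiv ℝ f (x + (s * r) • y) y) s := fun s _ => by
    have h1 : HasDerivAt (fun s : ℝ => x + (s * r) • y) (r • y) s := by
      simpa using (((hasDerivAt_id s).mul_const r).smul_const y).const_add x
    have h2 := ((hf.differentiable (by norm_num)) (x + (s * r) • y)).hasFDerivAt
    simpa [Function.comp_def] using h2.comp_hasDerivAt s h1
  have := intervalIntegral.integral_eq_sub_of_hasDerivAt hd (by
    refine Continuous.intervalIntegrable ?_ _ _
    exact ((hc.comp (by fun_prop)).clm_apply continuous_const).const_smul r)
  rw [intervalIntegral.integral_smul] at this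
  simpa [dividedDifference] using this

/-- The system solved by `(x, y, λ)` when `x` and `x + λ y` solve the system of the fields `f` with
controls `c` and `c + λ d`. -/
def diffField (f : ι → X → X) : ι ⊕ ι → X × X × ℝ → X × X × ℝ :=
  Sum.elim (fun i z => (f i z.1, dividedDifference (f i) z, 0))
    (fun i z => (0, f i (z.1 + z.2.2 • z.2.1), 0))

theorem locallyLipschitz_diffField [FiniteDimensional ℝ X] {f : ι → X → X}
    (hf : ∀ i, ContDiff ℝ 2 (f i)) (j : ι ⊕ ι) : LocallyLipschitz (diffField f j) := by
  rcases j with i | i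
  · refine LocallyLipschitz.prodMk ?_ ((locallyLipschitz_dividedDifference (hf i)).prodMk
      (LocallyLipschitz.const 0))
    exact (((hf i).of_le (by norm_num)).comp contDiff_fst : ContDiff ℝ 1 _).locallyLipschitz
  · refine LocallyLipschitz.prodMk (LocallyLipschitz.const 0) (LocallyLipschitz.prodMk ?_
      (LocallyLipschitz.const 0))
    exact (((hf i).of_le (by norm_num)).comp (by fun_prop) : ContDiff ℝ 1 _).locallyLipschitz

theorem diffField_snd_snd (f : ι → X → X) (j : ι ⊕ ι) (z : X × X × ℝ) :
    (diffField f j z).2.2 = 0 := by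
  rcases j with i | i <;> rfl

variable [Fintype ι]

/-- `y` solves the variational equation along `x`. -/
def IsVariation (T : ℝ) (f : ι → X → X) (c d : ι → ScalarControl T) (x y : ℝ → X) : Prop :=
  ContinuousOn y (Icc 0 T) ∧
  ∀ t ∈ Icc (0 : ℝ) T, y t = (∑ i, ∫ s in (0 : ℝ)..t, c i s • fderiv ℝ (f i) (x s) (y s)) +
    ∑ i, ∫ s in (0 : ℝ)..t, d i s • f i (x s)

variable {f : ι → X → X} {c d d' : ι → ScalarControl T} {x y y' : ℝ → X}

/-- At `λ = 0` the divided difference becomes the derivative. The variational equation is thus a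
slice of a locally Lipschitz system linear in the controls, and inherits uniqueness and weak
continuity from it. -/
theorem isSol_diffField_iff [FiniteDimensional ℝ X] (hf : ∀ i, ContDiff ℝ 2 (f i))
    (hx : IsSol T f 0 c x) :
    IsSol T (diffField f) (0, 0, 0) (Sum.elim c d) (fun t => (x t, y t, 0)) ↔
      IsVariation T f c d x y := by
  have : CompleteSpace X := FiniteDimensional.complete ℝ X
  have hcont := fun j => (locallyLipschitz_diffField hf j).continuous
  have key : ContinuousOn y (Icc 0 T) → ∀ t ∈ Icc (0 : ℝ) T,
      (((0 : X), (0 : X), (0 : ℝ)) + ∑ j, ∫ s in (0 : ℝ)..t, (Sum.elim c d j) s •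
        diffField f j (x s, y s, 0)) = (x t, (∑ i, ∫ s in (0 : ℝ)..t,
          c i s • fderiv ℝ (f i) (x s) (y s)) + ∑ i, ∫ s in (0 : ℝ)..t, d i s • f i (x s), 0) := by
    intro hy t ht
    have h0 : (0 : ℝ) ∈ Icc 0 T := ⟨le_rfl, ht.1.trans ht.2⟩
    have hzc : ContinuousOn (fun t => (x t, y t, (0 : ℝ))) (Icc 0 T) :=
      hx.1.prodMk (hy.prodMk continuousOn_const)
    have hgc : ∀ j, ContinuousOn (fun s => diffField f j (x s, y s, 0)) (Icc 0 T) := fun j =>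
      (hcont j).comp_continuousOn hzc
    rw [Prod.mk_zero_zero, Prod.mk_zero_zero, zero_add]
    refine Prod.ext ?_ (Prod.ext ?_ ?_)
    · refine (clm_sum_integral_control_smul (ContinuousLinearMap.fst ℝ X (X × ℝ)) _ hgc h0 ht).trans ?_
      rw [hx.2 t ht, Fintype.sum_sum_type]
      simp [diffField]
    · refine (clm_sum_integral_control_smul ((ContinuousLinearMap.fst ℝ X ℝ).comp
        (ContinuousLinearMap.snd ℝ X (X × ℝ))) _ hgc h0 ht).trans ?_
      rw [Fintype.sum_sum_type]
      simp [diffField, dividedDifference_zero]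
    · refine (clm_sum_integral_control_smul ((ContinuousLinearMap.snd ℝ X ℝ).comp
        (ContinuousLinearMap.snd ℝ X (X × ℝ))) _ hgc h0 ht).trans ?_
      rw [Fintype.sum_sum_type]
      simp [diffField]
  constructor
  · rintro ⟨h1, h2⟩
    have hy : ContinuousOn y (Icc 0 T) := h1.snd.fst
    refine ⟨hy, fun t ht => ?_⟩
    have := h2 t ht
    rw [key hy t ht] at this
    exact congrArg (fun z => z.2.1) this
  · rintro ⟨hy, h2⟩
    refine ⟨hx.1.prodMk (hy.prodMk continuousOn_const), fun t ht => ?_⟩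
    rw [key hy t ht, ← h2 t ht]

theorem IsVariation.add_smul [FiniteDimensional ℝ X] (hf : ∀ i, ContDiff ℝ 2 (f i))
    (hx : IsSol T f 0 c x) (hy : IsVariation T f c d x y) (hy' : IsVariation T f c d' x y')
    (r : ℝ) : IsVariation T f c (fun i => d i + r • d' i) x (fun t => y t + r • y' t) := by
  refine ⟨hy.1.add (hy'.1.const_smul r), fun t ht => ?_⟩
  have h0 : (0 : ℝ) ∈ Icc 0 T := ⟨le_rfl, ht.1.trans ht.2⟩
  have hDf : ∀ i, ContinuousOn (fun s => fderiv ℝ (f i) (x s)) (Icc 0 T) := fun i =>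
    ((hf i).continuous_fderiv (by norm_num)).comp_continuousOn hx.1
  have hfx : ∀ i, ContinuousOn (fun s => f i (x s)) (Icc 0 T) := fun i =>
    (hf i).continuous.comp_continuousOn hx.1
  beta_reduce
  rw [hy.2 t ht, hy'.2 t ht, smul_add, add_add_add_comm, Finset.smul_sum, Finset.smul_sum,
    ← Finset.sum_add_distrib, ← Finset.sum_add_distrib]
  congr 1 <;> refine Finset.sum_congr rfl fun i _ => ?_
  · have hr : IntervalIntegrable (fun s => r • c i s • fderiv ℝ (f i) (x s) (y' s)) volume 0 t :=
      (intervalIntegrable_control_smul _ ((hDf i).clm_apply hy'.1) h0 ht).smul r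
    rw [← intervalIntegral.integral_smul, ← intervalIntegral.integral_add
      (intervalIntegrable_control_smul _ ((hDf i).clm_apply hy.1) h0 ht) hr]
    refine intervalIntegral.integral_congr fun s _ => ?_
    simp only [map_add, map_smul, smul_add, smul_comm r]
  · rw [integral_control_add_smul _ _ (hfx i) h0 ht, integral_control_smul_smul r _ _ h0 ht]

theorem isVariation_zero : IsVariation T f c 0 x 0 := by
  refine ⟨continuousOn_const, fun t ht => ?_⟩
  have h0 : (0 : ℝ) ∈ Icc 0 T := ⟨le_rfl, ht.1.trans ht.2⟩
  have : ∀ i, ∫ s in (0 : ℝ)..t, (0 : ι → ScalarControl T) i s • f i (x s) = 0 := fun i => by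
    simpa using integral_control_smul_smul (T := T) 0 0 (fun s => f i (x s)) h0 ht
  rw [Finset.sum_congr rfl fun i _ => this i]
  simp

theorem IsSol.diffField_const [FiniteDimensional ℝ X] (hf : ∀ i, ContDiff ℝ 2 (f i))
    {e : ι ⊕ ι → ScalarControl T} {r : ℝ} {z : ℝ → X × X × ℝ}
    (hz : IsSol T (diffField f) (0, 0, r) e z) :
    ∀ t ∈ Icc 0 T, (z t).2.2 = r := by
  have : CompleteSpace X := FiniteDimensional.complete ℝ X
  intro t ht
  have := hz.map (h := fun _ _ => 0) (fun j => (locallyLipschitz_diffField hf j).continuous)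
    ((ContinuousLinearMap.snd ℝ X ℝ).comp (ContinuousLinearMap.snd ℝ X (X × ℝ)))
    (fun i t _ => diffField_snd_snd f i _)
  simpa using this.2 t ht

theorem IsSol.diffField_fst [FiniteDimensional ℝ X] (hf : ∀ i, ContDiff ℝ 2 (f i))
    {e : ι ⊕ ι → ScalarControl T} {r : ℝ} {z : ℝ → X × X × ℝ}
    (hz : IsSol T (diffField f) (0, 0, r) e z) :
    IsSol T f 0 (fun i => e (Sum.inl i)) (fun t => (z t).1) := by
  have : CompleteSpace X := FiniteDimensional.complete ℝ X
  have := hz.map (h := Sum.elim f (fun i z => (0 : ℝ) • f i z))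
    (fun j => (locallyLipschitz_diffField hf j).continuous)
    (ContinuousLinearMap.fst ℝ X (X × ℝ)) (by rintro (i | i) t _ <;> simp [diffField])
  simpa using this.combine fun i => (hf i).continuous

/-- The parameter `λ` stays equal to `r`, and `r` times the divided difference is `f (x + r y) - f
x`; hence the linear map `(x, y, λ) ↦ x + r y` carries the triple system to the original one. -/
theorem IsSol.diffField_add_smul [FiniteDimensional ℝ X] (hf : ∀ i, ContDiff ℝ 2 (f i))
    {e : ι ⊕ ι → ScalarControl T} {r : ℝ} {z : ℝ → X × X × ℝ}
    (hz : IsSol T (diffField f) (0, 0, r) e z) :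
    IsSol T f 0 (fun i => e (Sum.inl i) + r • e (Sum.inr i)) (fun t => (z t).1 + r • (z t).2.1) := by
  have : CompleteSpace X := FiniteDimensional.complete ℝ X
  have := hz.map (h := Sum.elim f (fun i z => r • f i z))
    (fun j => (locallyLipschitz_diffField hf j).continuous)
    (ContinuousLinearMap.fst ℝ X (X × ℝ) + r • (ContinuousLinearMap.fst ℝ X ℝ).comp
        (ContinuousLinearMap.snd ℝ X (X × ℝ))) (by
      rintro (i | i) t ht
      · have h1 := smul_dividedDifference (hf i) (z t).1 (z t).2.1 r
        have h2 : z t = ((z t).1, (z t).2.1, r) := by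
          rw [← hz.diffField_const hf t ht]
        rw [← h2] at h1
        simp [diffField, h1]
      · simp [diffField, hz.diffField_const hf t ht])
  simpa using this.combine fun i => (hf i).continuous

end Variation
end

noncomputable section
section Variation

variable {X : Type*} [NormedAddCommGroup X] [NormedSpace ℝ X]
variable {ι : Type*} [Fintype ι] {T : ℝ}
variable {f : ι → X → X} {c d : ι → ScalarControl T} {x y : ℝ → X}

theorem IsVariation.congr {x' y' : ℝ → X} (hy : IsVariation T f c d x y)
    (hx : EqOn x x' (Icc 0 T)) (hyy : EqOn y y' (Icc 0 T)) : IsVariation T f c d x' y' := by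
  refine ⟨hy.1.congr hyy.symm, fun t ht => ?_⟩
  rw [← hyy ht, hy.2 t ht]
  congr 1 <;> refine Finset.sum_congr rfl fun i _ => intervalIntegral.integral_congr fun s hs => ?_
  all_goals
    rw [uIcc_of_le ht.1] at hs
    have hs' : s ∈ Icc 0 T := ⟨hs.1, hs.2.trans ht.2⟩
    simp only [hx hs', hyy hs']

theorem IsSol.congr_eqOn {Y : Type*} [NormedAddCommGroup Y] [NormedSpace ℝ Y] {g : ι → Y → Y}
    {a : Y} {x x' : ℝ → Y} (hx : IsSol T g a c x) (h : EqOn x x' (Icc 0 T)) :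
    IsSol T g a c x' := by
  refine ⟨hx.1.congr h.symm, fun t ht => ?_⟩
  rw [← h ht, hx.2 t ht]
  congr 1
  refine Finset.sum_congr rfl fun i _ => intervalIntegral.integral_congr fun s hs => ?_
  rw [uIcc_of_le ht.1] at hs
  simp only [h ⟨hs.1, hs.2.trans ht.2⟩]

theorem IsSol.isVariation_of_diffField [FiniteDimensional ℝ X] (hf : ∀ i, ContDiff ℝ 2 (f i))
    {e : ι ⊕ ι → ScalarControl T} {z : ℝ → X × X × ℝ}
    (hz : IsSol T (diffField f) (0, 0, 0) e z) :
    IsVariation T f (fun i => e (Sum.inl i)) (fun i => e (Sum.inr i))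
      (fun t => (z t).1) (fun t => (z t).2.1) := by
  refine (isSol_diffField_iff hf (hz.diffField_fst hf)).1 ?_
  have : Sum.elim (fun i => e (Sum.inl i)) (fun i => e (Sum.inr i)) = e := by
    funext j; rcases j with i | i <;> rfl
  rw [this]
  refine hz.congr_eqOn fun t ht => ?_
  rw [← hz.diffField_const hf t ht]

/-- The variational equation is solvable along a solution. -/
theorem IsSol.exists_isVariation [FiniteDimensional ℝ X] (hT : 0 ≤ T) (hf : ∀ i, ContDiff ℝ 2 (f i))
    (hx : IsSol T f 0 c x) (d : ι → ScalarControl T) : ∃ y, IsVariation T f c d x y := by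
  -- The zero variation solves the equation for `d = 0`, and it persists for the control `r • d`
  -- with `r` small. One nonzero `r` suffices, since the equation is linear in `(y, d)` and can be
  -- rescaled by `r⁻¹`.
  have h0 : IsSol T (diffField f) (0, 0, 0) (Sum.elim c 0) (fun t => (x t, (0 : ℝ → X) t, 0)) :=
    (isSol_diffField_iff hf hx).2 isVariation_zero
  have hlim : ∀ j : ι ⊕ ι, WeakTendsto (fun r : ℝ => Sum.elim c (fun i => r • d i) j) (𝓝[≠] 0)
      (Sum.elim c 0 j) := by
    rintro (i | i)
    · exact tendsto_const_nhds.weakTendsto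
    · refine Tendsto.weakTendsto (Tendsto.mono_left ?_ nhdsWithin_le_nhds)
      have : Continuous fun r : ℝ => r • d i := by fun_prop
      simpa using this.tendsto 0
  obtain ⟨z, hz, -⟩ := h0.eventually_exists hT (locallyLipschitz_diffField hf)
    (a' := fun _ => (0, 0, 0)) tendsto_const_nhds hlim
  obtain ⟨r, hr, hr0⟩ := (hz.and self_mem_nhdsWithin).exists
  have hr0' : r ≠ 0 := hr0
  have h1 := hr.isVariation_of_diffField hf
  have h2 : EqOn (fun t => (z r t).1) x (Icc 0 T) := (hr.diffField_fst hf).unique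
    (fun i => ((hf i).of_le (by norm_num) : ContDiff ℝ 1 (f i)).locallyLipschitz) hx
  have h3 := h1.congr h2 fun _ _ => rfl
  have h4 := (isVariation_zero (f := f) (c := c) (x := x)).add_smul hf hx h3 r⁻¹
  have h5 : (fun i => (0 : ι → ScalarControl T) i +
      r⁻¹ • Sum.elim c (fun i => r • d i) (Sum.inr i)) = d := by
    funext i
    simp [smul_smul, inv_mul_cancel₀ hr0']
  rw [h5] at h4
  exact ⟨_, h4⟩

/-- Joint weak continuity of the solutions and of their divided differences. -/
theorem IsSol.eventually_exists_diff [FiniteDimensional ℝ X] (hT : 0 ≤ T) (hf : ∀ i, ContDiff ℝ 2 (f i))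
    (hx : IsSol T f 0 c x) (hy : IsVariation T f c d x y) {α : Type*} {l : Filter α}
    {c' d' : α → ι → ScalarControl T} {r : α → ℝ} (hr : Tendsto r l (𝓝 0))
    (hc : ∀ i, WeakTendsto (fun k => c' k i) l (c i))
    (hd : ∀ i, WeakTendsto (fun k => d' k i) l (d i)) :
    ∃ x' y' : α → ℝ → X,
      (∀ᶠ k in l, IsSol T f 0 (c' k) (x' k) ∧
        IsSol T f 0 (fun i => c' k i + r k • d' k i) (fun t => x' k t + r k • y' k t) ∧
        (r k = 0 → IsVariation T f (c' k) (d' k) (x' k) (y' k))) ∧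
      Tendsto (fun k => y' k T) l (𝓝 (y T)) := by
  have h0 := (isSol_diffField_iff hf hx).2 hy
  have hlim : ∀ j : ι ⊕ ι, WeakTendsto (fun k => Sum.elim (c' k) (d' k) j) l (Sum.elim c d j) := by
    rintro (i | i)
    exacts [hc i, hd i]
  obtain ⟨z, hz, hzT⟩ := h0.eventually_exists hT (locallyLipschitz_diffField hf)
    (a' := fun k => (0, 0, r k)) (tendsto_const_nhds.prodMk_nhds
      (tendsto_const_nhds.prodMk_nhds hr)) hlim
  refine ⟨fun k t => (z k t).1, fun k t => (z k t).2.1, ?_, ?_⟩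
  · filter_upwards [hz] with k hk
    refine ⟨hk.diffField_fst hf, hk.diffField_add_smul hf, fun hrk => ?_⟩
    rw [hrk] at hk
    exact hk.isVariation_of_diffField hf
  · exact (continuous_fst.comp continuous_snd).continuousAt.tendsto.comp hzT

end Variation

/-! ### The control-affine system as a driftless one -/

section Endpoint

variable {X : Type*} [NormedAddCommGroup X] [NormedSpace ℝ X] {m : ℕ} {T : ℝ}

/-- The drift as a control. -/
def driftControl (m : ℕ) (T : ℝ) : Option (Fin m) → ScalarControl T
  | none => (memLp_const (1 : ℝ)).toLp _
  | some _ => 0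

/-- The components of a control, with a zero component along the drift. -/
def controlPart (m : ℕ) (T : ℝ) : Control T m →L[ℝ] (Option (Fin m) → ScalarControl T) :=
  ContinuousLinearMap.pi fun o => o.elim 0 fun i =>
    (EuclideanSpace.proj i : EuclideanSpace ℝ (Fin m) →L[ℝ] ℝ).compLpL 2 _

/-- The drift and the controlled vector fields, as a single family. -/
def fieldFamily (f₀ : X → X) (f : Fin m → X → X) : Option (Fin m) → X → X
  | none => f₀
  | some i => f i

/-- The drift is treated as one more field, driven by the constant control `1`; the system becomes
linear in its controls and the preceding theory applies. -/
theorem isTrajectory_iff (hT : 0 ≤ T) {f₀ : X → X} {f : Fin m → X → X} (hf₀ : Continuous f₀)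
    (hf : ∀ i, Continuous (f i)) {u : Control T m} {x : ℝ → X} :
    IsTrajectory (affineField f₀ f) T u x ↔
      IsSol T (fieldFamily f₀ f) 0 (driftControl m T + controlPart m T u) x := by
  have hae : ∀ᵐ s ∂volume.restrict (Icc (0 : ℝ) T), ∀ o : Option (Fin m),
      (driftControl m T + controlPart m T u) o s = o.elim 1 (fun i => u s i) := by
    rw [ae_all_iff]
    rintro (_ | i)
    · have h := (memLp_const (μ := volume.restrict (Icc (0 : ℝ) T)) (p := 2) (1 : ℝ)).coeFn_toLp
      have : (driftControl m T + controlPart m T u) none = (memLp_const (1 : ℝ)).toLp _ := by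
        simp [driftControl, controlPart]
      rw [this]
      filter_upwards [h] with s hs
      rw [hs]; rfl
    · have : (driftControl m T + controlPart m T u) (some i) =
          (EuclideanSpace.proj i : EuclideanSpace ℝ (Fin m) →L[ℝ] ℝ).compLpL 2 _ u := by
        simp [driftControl, controlPart]
      rw [this]
      filter_upwards [ContinuousLinearMap.coeFn_compLpL
        (EuclideanSpace.proj i : EuclideanSpace ℝ (Fin m) →L[ℝ] ℝ) u] with s hs
      rw [hs]; rfl
  have hff : ∀ o, Continuous (fieldFamily f₀ f o) := by
    rintro (_ | i)
    exacts [hf₀, hf i]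
  have hF : (fun s => affineField f₀ f (x s) (u s)) =ᵐ[volume.restrict (Icc (0 : ℝ) T)]
      fun s => ∑ o, (driftControl m T + controlPart m T u) o s • fieldFamily f₀ f o (x s) := by
    filter_upwards [hae] with s hs
    simp only [hs, Fintype.sum_option, affineField, fieldFamily, Option.elim, one_smul]
  have hint : ContinuousOn x (Icc 0 T) → ∀ t ∈ Icc 0 T, ∀ o, IntervalIntegrable
      (fun s => (driftControl m T + controlPart m T u) o s • fieldFamily f₀ f o (x s))
      volume 0 t := fun hx t ht o =>
    intervalIntegrable_control_smul _ ((hff o).comp_continuousOn hx)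
      ⟨le_rfl, ht.1.trans ht.2⟩ ht
  have heq : ContinuousOn x (Icc 0 T) → ∀ t ∈ Icc 0 T,
      ∫ s in (0 : ℝ)..t, affineField f₀ f (x s) (u s) =
      0 + ∑ o, ∫ s in (0 : ℝ)..t,
        (driftControl m T + controlPart m T u) o s • fieldFamily f₀ f o (x s) := by
    intro hx t ht
    rw [intervalIntegral_congr_ae_Icc hF ⟨le_rfl, ht.1.trans ht.2⟩ ht, zero_add,
      intervalIntegral.integral_finsetSum fun o _ => hint hx t ht o]
  constructor
  · rintro ⟨h1, -, h2⟩
    exact ⟨h1, fun t ht => by rw [h2 t ht, heq h1 t ht]⟩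
  · rintro ⟨h1, h2⟩
    refine ⟨h1, ?_, fun t ht => by rw [h2 t ht, heq h1 t ht]⟩
    have h3 := IntervalIntegrable.sum (μ := volume) (a := 0) (b := T) Finset.univ
      fun o _ => hint h1 T ⟨hT, le_rfl⟩ o
    refine h3.congr_ae ?_
    have hsub : uIoc 0 T ⊆ Icc 0 T := by rw [uIoc_of_le hT]; exact Ioc_subset_Icc_self
    filter_upwards [ae_restrict_of_ae_restrict_of_subset hsub hF] with s hs
    rw [hs, Finset.sum_apply]

end Endpoint
end

/-! ### Weak continuity and differentiability of the end-point map -/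

noncomputable section

/-- Bounded families in a Hilbert space converge weakly along ultrafilters. -/
theorem exists_weakTendsto {α H : Type*} [NormedAddCommGroup H] [InnerProductSpace ℝ H]
    [CompleteSpace H] (l : Ultrafilter α) {v : α → H} {R : ℝ} (hv : ∀ᶠ k in (l : Filter α), ‖v k‖ ≤ R) :
    ∃ v₀, WeakTendsto v l v₀ ∧ ‖v₀‖ ≤ R := by
  let e := InnerProductSpace.toDual ℝ H
  let w : α → WeakDual ℝ H := fun k => StrongDual.toWeakDual (e (v k))
  have hmem : ∀ᶠ k in (l : Filter α), w k ∈ WeakDual.toStrongDual ⁻¹' Metric.closedBall 0 R := by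
    filter_upwards [hv] with k hk
    simpa [w] using hk
  obtain ⟨ψ, hψ, hlim⟩ := (WeakDual.isCompact_closedBall (𝕜 := ℝ) (E := H) 0 R).ultrafilter_le_nhds
    (l.map w) (le_principal_iff.2 hmem)
  refine ⟨e.symm (WeakDual.toStrongDual ψ), ⟨⟨R, hv⟩, fun φ => ?_⟩, ?_⟩
  · have h1 : Tendsto (fun k => w k (e.symm φ)) l (𝓝 (ψ (e.symm φ))) :=
      (WeakDual.eval_continuous (e.symm φ)).continuousAt.tendsto.comp hlim
    have h2 : ∀ z, φ z = inner ℝ z (e.symm φ) := fun z => by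
      rw [real_inner_comm]
      exact (InnerProductSpace.toDual_symm_apply).symm
    have h3 : ψ (e.symm φ) = φ (e.symm (WeakDual.toStrongDual ψ)) := by
      rw [h2]
      exact (InnerProductSpace.toDual_symm_apply).symm
    rw [← h3]
    refine h1.congr fun k => ?_
    rw [h2]
    rfl
  · rw [LinearIsometryEquiv.norm_map]
    simpa using hψ

section Endpoint

variable {X : Type*} [NormedAddCommGroup X] [NormedSpace ℝ X] {m : ℕ} {T : ℝ}
  {f₀ : X → X} {f : Fin m → X → X}

theorem contDiff_fieldFamily (hf₀ : ContDiff ℝ 2 f₀) (hf : ∀ i, ContDiff ℝ 2 (f i)) :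
    ∀ o, ContDiff ℝ 2 (fieldFamily f₀ f o) := by
  rintro (_ | i)
  exacts [hf₀, hf i]

theorem mem_admissible_iff (hT : 0 ≤ T) (hf₀ : ContDiff ℝ 2 f₀) (hf : ∀ i, ContDiff ℝ 2 (f i))
    {u : Control T m} : u ∈ admissible (affineField f₀ f) T ↔
      ∃ x, IsSol T (fieldFamily f₀ f) 0 (driftControl m T + controlPart m T u) x :=
  exists_congr fun _ => isTrajectory_iff hT hf₀.continuous fun i => (hf i).continuous

variable [FiniteDimensional ℝ X]

theorem IsVariation.unique {ι : Type*} [Fintype ι] {f : ι → X → X} {c d : ι → ScalarControl T}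
    {x x' y y' : ℝ → X} (hT : 0 ≤ T) (hf : ∀ i, ContDiff ℝ 2 (f i)) (hx : IsSol T f 0 c x)
    (hx' : IsSol T f 0 c x')
    (hy : IsVariation T f c d x y) (hy' : IsVariation T f c d x' y') : y T = y' T := by
  have h1 := (isSol_diffField_iff hf hx).2 hy
  have h2 := (isSol_diffField_iff hf hx').2 hy'
  exact congrArg (fun z => z.2.1) (h1.unique (locallyLipschitz_diffField hf) h2 ⟨hT, le_rfl⟩)

theorem endpoint_eq (hT : 0 ≤ T) (hf₀ : ContDiff ℝ 2 f₀) (hf : ∀ i, ContDiff ℝ 2 (f i))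
    {u : Control T m} {x : ℝ → X}
    (hx : IsSol T (fieldFamily f₀ f) 0 (driftControl m T + controlPart m T u) x) :
    endpoint (affineField f₀ f) T u = x T := by
  have h : ∃ x, IsTrajectory (affineField f₀ f) T u x :=
    (mem_admissible_iff hT hf₀ hf).2 ⟨x, hx⟩
  rw [endpoint, dif_pos h]
  exact ((isTrajectory_iff hT hf₀.continuous fun i => (hf i).continuous).1 h.choose_spec).unique
    (fun i => ((contDiff_fieldFamily hf₀ hf i).of_le (by norm_num) :
      ContDiff ℝ 1 _).locallyLipschitz) hx ⟨hT, le_rfl⟩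

theorem weakTendsto_control {α : Type*} {l : Filter α} {v : α → Control T m} {u : Control T m}
    (h : WeakTendsto v l u) (o : Option (Fin m)) :
    WeakTendsto (fun k => (driftControl m T + controlPart m T (v k)) o) l
      ((driftControl m T + controlPart m T u) o) :=
  tendsto_const_nhds.weakTendsto.add
    (h.clm_comp ((ContinuousLinearMap.proj o).comp (controlPart m T)))

theorem WeakTendsto.tendsto_endpoint (hT : 0 ≤ T) (hf₀ : ContDiff ℝ 2 f₀)
    (hf : ∀ i, ContDiff ℝ 2 (f i)) {u : Control T m} (hu : u ∈ admissible (affineField f₀ f) T)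
    {α : Type*} {l : Filter α} {v : α → Control T m} (hv : WeakTendsto v l u) :
    (∀ᶠ k in l, v k ∈ admissible (affineField f₀ f) T) ∧
    Tendsto (fun k => endpoint (affineField f₀ f) T (v k)) l
      (𝓝 (endpoint (affineField f₀ f) T u)) := by
  obtain ⟨x, hx⟩ := (mem_admissible_iff hT hf₀ hf).1 hu
  obtain ⟨x', hx', hlim⟩ := hx.eventually_exists hT
    (fun i => ((contDiff_fieldFamily hf₀ hf i).of_le (by norm_num) :
      ContDiff ℝ 1 _).locallyLipschitz) (a' := fun _ => 0) tendsto_const_nhds (weakTendsto_control hv)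
  refine ⟨hx'.mono fun k hk => (mem_admissible_iff hT hf₀ hf).2 ⟨_, hk⟩, ?_⟩
  rw [endpoint_eq hT hf₀ hf hx]
  exact hlim.congr' (hx'.mono fun k hk => (endpoint_eq hT hf₀ hf hk).symm)

/-- `L` is the endpoint of the variational equation along the trajectory of `u`. -/
def IsEndpointVariation (T : ℝ) (f₀ : X → X) (f : Fin m → X → X) (u : Control T m)
    (L : Control T m →L[ℝ] X) : Prop :=
  ∀ x, IsSol T (fieldFamily f₀ f) 0 (driftControl m T + controlPart m T u) x → ∀ ξ y,
    IsVariation T (fieldFamily f₀ f) (driftControl m T + controlPart m T u) (controlPart m T ξ) x y →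
    L ξ = y T

/-- Linearity comes from uniqueness for the variational equation, and continuity at `0` from its
continuous dependence on the control variation. -/
theorem exists_isEndpointVariation (hT : 0 ≤ T) (hf₀ : ContDiff ℝ 2 f₀)
    (hf : ∀ i, ContDiff ℝ 2 (f i)) (u : Control T m) (hu : u ∈ admissible (affineField f₀ f) T) :
    ∃ L, IsEndpointVariation T f₀ f u L := by
  have hg := contDiff_fieldFamily hf₀ hf
  obtain ⟨x, hx⟩ := (mem_admissible_iff hT hf₀ hf).1 hu
  choose y hy using fun ξ => hx.exists_isVariation hT hg (controlPart m T ξ)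
  have hlin : ∀ (ξ η : Control T m) (r : ℝ), y (ξ + r • η) T = y ξ T + r • y η T := fun ξ η r => by
    refine (hy (ξ + r • η)).unique hT hg hx hx (y' := fun t => y ξ t + r • y η t) ?_
    have := (hy ξ).add_smul hg hx (hy η) r
    rwa [map_add, map_smul]
  let A : Control T m →ₗ[ℝ] X :=
    { toFun := fun ξ => y ξ T
      map_add' := fun ξ η => by simpa using hlin ξ η 1
      map_smul' := fun r ξ => by
        have h0 := hlin 0 0 1
        simp only [smul_zero, one_smul, add_zero, left_eq_add] at h0
        simpa [h0] using hlin 0 ξ r }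
  have hA : Continuous A := by
    refine continuous_of_continuousAt_zero A ?_
    obtain ⟨x', y', h1, h2⟩ := hx.eventually_exists_diff hT hg
      (isVariation_zero (f := fieldFamily f₀ f)) (l := 𝓝 (0 : Control T m))
      (r := fun _ => 0) tendsto_const_nhds
      (c' := fun _ => driftControl m T + controlPart m T u) (d' := fun ξ => controlPart m T ξ)
      (fun i => tendsto_const_nhds.weakTendsto) (fun i => Tendsto.weakTendsto (by
        have : Continuous fun ξ => controlPart m T ξ i :=
          (continuous_apply i).comp (controlPart m T).continuous
        simpa using this.tendsto 0))
    rw [ContinuousAt, map_zero]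
    refine h2.congr' ?_
    filter_upwards [h1] with ξ hξ
    exact (hξ.2.2 rfl).unique hT hg hξ.1 hx (hy ξ)
  refine ⟨⟨A, hA⟩, fun x' hx' ξ y' hy' => ?_⟩
  exact (hy ξ).unique hT hg hx hx' hy'

/-- The common source of strict differentiability (`r k` the distance between two controls) and of
continuity of the differential (`r k = 0`, where the quotient `q k` is a derivative). All
convergences of controls are weak. -/
theorem exists_tendsto_diff_endpoint (hT : 0 ≤ T) (hf₀ : ContDiff ℝ 2 f₀)
    (hf : ∀ i, ContDiff ℝ 2 (f i)) {u : Control T m} (hu : u ∈ admissible (affineField f₀ f) T)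
    {L : Control T m →L[ℝ] X} (hL : IsEndpointVariation T f₀ f u L)
    {α : Type*} {l : Filter α} {v ξ : α → Control T m} {ξ₀ : Control T m} {r : α → ℝ}
    (hv : WeakTendsto v l u) (hξ : WeakTendsto ξ l ξ₀) (hr : Tendsto r l (𝓝 0)) :
    ∃ q : α → X, Tendsto q l (𝓝 (L ξ₀)) ∧ ∀ᶠ k in l,
      endpoint (affineField f₀ f) T (v k + r k • ξ k) =
        endpoint (affineField f₀ f) T (v k) + r k • q k ∧
      (r k = 0 → ∀ L', IsEndpointVariation T f₀ f (v k) L' → L' (ξ k) = q k) := by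
  have hg := contDiff_fieldFamily hf₀ hf
  obtain ⟨x, hx⟩ := (mem_admissible_iff hT hf₀ hf).1 hu
  obtain ⟨y, hy⟩ := hx.exists_isVariation hT hg (controlPart m T ξ₀)
  obtain ⟨x', y', h1, h2⟩ := hx.eventually_exists_diff hT hg hy hr (weakTendsto_control hv)
    (d' := fun k => controlPart m T (ξ k))
    (fun o => hξ.clm_comp ((ContinuousLinearMap.proj o).comp (controlPart m T)))
  refine ⟨fun k => y' k T, by rwa [hL x hx ξ₀ y hy], ?_⟩
  filter_upwards [h1] with k hk
  refine ⟨?_, fun hrk L' hL' => hL' _ hk.1 _ _ (hk.2.2 hrk)⟩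
  rw [endpoint_eq hT hf₀ hf hk.1]
  refine endpoint_eq hT hf₀ hf (x := fun t => x' k t + r k • y' k t) ?_
  have : driftControl m T + controlPart m T (v k + r k • ξ k) = fun i =>
      (driftControl m T + controlPart m T (v k)) i + r k • controlPart m T (ξ k) i := by
    rw [map_add, map_smul, ← add_assoc]; rfl
  rw [this]
  exact hk.2.1

/-- Normalized increments have a weak limit `ξ₀` along an ultrafilter. Both the difference quotients
and `L ξ` tend to `L ξ₀`, the latter because the target is finite-dimensional. -/
theorem IsEndpointVariation.hasStrictFDerivAt (hT : 0 ≤ T) (hf₀ : ContDiff ℝ 2 f₀)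
    (hf : ∀ i, ContDiff ℝ 2 (f i)) {u : Control T m} (hu : u ∈ admissible (affineField f₀ f) T)
    {L : Control T m →L[ℝ] X} (hL : IsEndpointVariation T f₀ f u L) :
    HasStrictFDerivAt (endpoint (affineField f₀ f) T) L u := by
  rw [hasStrictFDerivAt_iff_isLittleO, Asymptotics.isLittleO_iff]
  intro ε hε
  refine mem_iff_ultrafilter.2 fun g hg => ?_
  let r : Control T m × Control T m → ℝ := fun p => ‖p.1 - p.2‖
  let ξ : Control T m × Control T m → Control T m := fun p => (r p)⁻¹ • (p.1 - p.2)
  have hξr : ∀ p, p.1 - p.2 = r p • ξ p := fun p => by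
    rcases eq_or_ne (p.1 - p.2) 0 with h | h
    · simp [ξ, h]
    · simp only [ξ, r, smul_smul]
      rw [mul_inv_cancel₀ (norm_ne_zero_iff.2 h), one_smul]
  have hξ1 : ∀ p, ‖ξ p‖ ≤ 1 := fun p => by
    simp only [ξ, r, norm_smul, norm_inv, norm_norm]
    exact inv_mul_le_one
  obtain ⟨ξ₀, hξ₀, -⟩ := exists_weakTendsto g (Eventually.of_forall hξ1)
  have h2 : Tendsto (fun p : Control T m × Control T m => p.2) g (𝓝 u) :=
    (continuous_snd.tendsto (u, u)).mono_left hg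
  have hr : Tendsto r g (𝓝 0) := by
    have : Continuous r := by fun_prop
    simpa [r] using (this.tendsto (u, u)).mono_left hg
  obtain ⟨q, hq, hk⟩ := exists_tendsto_diff_endpoint hT hf₀ hf hu hL h2.weakTendsto hξ₀ hr
  have hlim : Tendsto (fun p => q p - L (ξ p)) g (𝓝 0) := by
    simpa using hq.sub (hξ₀.tendsto_clm L)
  filter_upwards [hk, hlim.norm.eventually_lt_const (by simpa using hε)] with p hp hp'
  have e1 : p.1 = p.2 + r p • ξ p := by rw [← hξr]; abel
  have e2 : endpoint (affineField f₀ f) T p.1 - endpoint (affineField f₀ f) T p.2 - L (p.1 - p.2)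
      = r p • (q p - L (ξ p)) := by
    conv_lhs => rw [hξr p, e1, hp.1]
    rw [map_smul, smul_sub]; abel
  rw [e2, norm_smul, mul_comm]
  simp only [r, norm_norm]
  exact mul_le_mul_of_nonneg_right hp'.le (norm_nonneg _)

theorem exists_hasStrictFDerivAt_endpoint (hT : 0 ≤ T) (hf₀ : ContDiff ℝ 2 f₀)
    (hf : ∀ i, ContDiff ℝ 2 (f i)) {u : Control T m} (hu : u ∈ admissible (affineField f₀ f) T) :
    HasStrictFDerivAt (endpoint (affineField f₀ f) T) (fderiv ℝ (endpoint (affineField f₀ f) T) u) u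
    ∧ IsEndpointVariation T f₀ f u (fderiv ℝ (endpoint (affineField f₀ f) T) u) := by
  obtain ⟨L, hL⟩ := exists_isEndpointVariation hT hf₀ hf u hu
  have h := hL.hasStrictFDerivAt hT hf₀ hf hu
  rw [h.hasFDerivAt.fderiv]
  exact ⟨h, hL⟩

/-- The differential of the endpoint map is continuous from the weak topology on bounded sets to
the norm topology. -/
theorem WeakTendsto.tendsto_fderiv_endpoint (hT : 0 ≤ T) (hf₀ : ContDiff ℝ 2 f₀)
    (hf : ∀ i, ContDiff ℝ 2 (f i)) {u : Control T m} (hu : u ∈ admissible (affineField f₀ f) T)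
    {α : Type*} {l : Filter α} {v : α → Control T m} (hv : WeakTendsto v l u) :
    Tendsto (fun k => fderiv ℝ (endpoint (affineField f₀ f) T) (v k)) l
      (𝓝 (fderiv ℝ (endpoint (affineField f₀ f) T) u)) := by
  set D := fderiv ℝ (endpoint (affineField f₀ f) T)
  rw [tendsto_iff_norm_sub_tendsto_zero, Metric.tendsto_nhds]
  intro ε hε
  refine mem_iff_ultrafilter.2 fun g hg => ?_
  -- Almost-norming unit vectors turn operator-norm convergence into convergence along one weakly
  -- convergent family of directions.
  have hex : ∀ k, ∃ ξ, ‖ξ‖ ≤ 1 ∧ (ε ≤ ‖D (v k) - D u‖ → ε / 2 ≤ ‖(D (v k) - D u) ξ‖) := fun k => by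
    by_cases h : ε ≤ ‖D (v k) - D u‖
    · obtain ⟨ξ, h1, h2⟩ := (D (v k) - D u).exists_lt_apply_of_lt_opNorm
        (show ε / 2 < _ by linarith)
      exact ⟨ξ, h1.le, fun _ => h2.le⟩
    · exact ⟨0, by simp, fun h' => absurd h' h⟩
  choose ξ hξ1 hξ2 using hex
  obtain ⟨ξ₀, hξ₀, -⟩ := exists_weakTendsto g (Eventually.of_forall hξ1)
  obtain ⟨q, hq, hk⟩ := exists_tendsto_diff_endpoint hT hf₀ hf hu
    (exists_hasStrictFDerivAt_endpoint hT hf₀ hf hu).2 (hv.mono hg) hξ₀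
    (r := fun _ => 0) tendsto_const_nhds
  have hlim : Tendsto (fun k => q k - D u (ξ k)) g (𝓝 0) := by
    simpa [D] using hq.sub (hξ₀.tendsto_clm (D u))
  filter_upwards [hk, hlim.norm.eventually_lt_const (show ‖(0 : X)‖ < ε / 2 by simpa using hε),
    ((hv.tendsto_endpoint hT hf₀ hf hu).1.filter_mono hg)] with k h1 h2 h3
  rw [Real.dist_eq, sub_zero, abs_norm]
  by_contra hbad
  have h4 := hξ2 k (not_lt.1 hbad)
  rw [sub_apply, h1.2 rfl _ (exists_hasStrictFDerivAt_endpoint hT hf₀ hf h3).2] at h4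
  linarith

theorem isOpen_admissible (hT : 0 ≤ T) (hf₀ : ContDiff ℝ 2 f₀) (hf : ∀ i, ContDiff ℝ 2 (f i)) :
    IsOpen (admissible (affineField f₀ f) T : Set (Control T m)) :=
  isOpen_iff_mem_nhds.2 fun _ hu =>
    ((tendsto_id (α := Control T m)).weakTendsto.tendsto_endpoint hT hf₀ hf hu).1

theorem contDiffAt_endpoint (hT : 0 ≤ T) (hf₀ : ContDiff ℝ 2 f₀) (hf : ∀ i, ContDiff ℝ 2 (f i))
    {u : Control T m} (hu : u ∈ admissible (affineField f₀ f) T) :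
    ContDiffAt ℝ 1 (endpoint (affineField f₀ f) T) u := by
  have hopen := isOpen_admissible (m := m) hT hf₀ hf
  refine ContDiffOn.contDiffAt (s := admissible (affineField f₀ f) T) ?_ (hopen.mem_nhds hu)
  rw [show (1 : WithTop ℕ∞) = 0 + 1 by rfl, contDiffOn_succ_iff_fderiv_of_isOpen hopen]
  refine ⟨fun v hv => ?_, by simp, contDiffOn_zero.2 fun v hv => ?_⟩
  · exact (exists_hasStrictFDerivAt_endpoint hT hf₀ hf
      hv).1.hasFDerivAt.differentiableAt.differentiableWithinAt
  · exact (WeakTendsto.tendsto_fderiv_endpoint hT hf₀ hf hv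
      (tendsto_id (α := Control T m)).weakTendsto).mono_left nhdsWithin_le_nhds

end Endpoint
end

noncomputable section

/-! ### Submersions and annihilating functionals -/

section Calculus

variable {U V : Type*} [NormedAddCommGroup U] [NormedSpace ℝ U] [NormedAddCommGroup V]
  [NormedSpace ℝ V]

/-- A right inverse `R'` of `A` makes `B ∘ R'` close to the identity, hence invertible, for `B` near
`A`. -/
theorem ContinuousLinearMap.eventually_surjective [FiniteDimensional ℝ V] {A : U →L[ℝ] V}
    (hA : Function.Surjective A) : ∀ᶠ B : U →L[ℝ] V in 𝓝 A, Function.Surjective B := by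
  have : CompleteSpace V := FiniteDimensional.complete ℝ V
  obtain ⟨R, hR⟩ := (A : U →ₗ[ℝ] V).exists_rightInverse_of_surjective (LinearMap.range_eq_top.2 hA)
  let R' : V →L[ℝ] U := R.toContinuousLinearMap
  have h1 : A.comp R' = 1 := by
    ext z
    exact LinearMap.congr_fun hR z
  have hc : Continuous fun B : U →L[ℝ] V => B.comp R' := by fun_prop
  have h2 : ∀ᶠ B : U →L[ℝ] V in 𝓝 A, IsUnit (B.comp R') := by
    refine hc.continuousAt.eventually (p := fun C => IsUnit C) ?_
    beta_reduce
    rw [h1]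
    exact Units.isOpen.mem_nhds isUnit_one
  filter_upwards [h2] with B hB z
  obtain ⟨C, hC⟩ := hB.exists_right_inv
  exact ⟨R' (C z), by simpa using DFunLike.congr_fun hC z⟩

/-- If a functional vanishes on the kernel of the derivative of a submersion at all points of a level
set, then the corresponding coordinate is locally constant on that level set. -/
theorem eventually_snd_eq_zero_of_submersion [CompleteSpace U] [FiniteDimensional ℝ V]
    {Φ : U × ℝ → V} {v : U} (hΦ : ContDiffAt ℝ 1 Φ (v, 0)) (h0 : Φ (v, 0) = 0)
    (hsurj : Function.Surjective (fderiv ℝ Φ (v, 0)))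
    (hker : ∀ᶠ z in 𝓝 (v, (0 : ℝ)), Φ z = 0 → ∀ ζ, fderiv ℝ Φ z ζ = 0 → ζ.2 = 0) :
    ∀ᶠ z in 𝓝 (v, (0 : ℝ)), Φ z = 0 → z.2 = 0 := by
  have : CompleteSpace V := FiniteDimensional.complete ℝ V
  have hf := hΦ.hasStrictFDerivAt one_ne_zero
  have hrange : (fderiv ℝ Φ (v, 0)).range = ⊤ := LinearMap.range_eq_top.2 hsurj
  let φ := hf.implicitFunctionDataOfComplemented Φ _ hrange
    (ContinuousLinearMap.ker_closedComplemented_of_finiteDimensional_range _)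
  have hpt : φ.pt = (v, 0) := rfl
  have hleft : φ.leftFun = Φ := rfl
  have hright : ContDiff ℝ 1 φ.rightFun :=
    (ContinuousLinearMap.contDiff _).comp (contDiff_id.sub contDiff_const)
  have hr0 : φ.rightFun (v, 0) = 0 := by
    simp [φ, HasStrictFDerivAt.implicitFunctionDataOfComplemented]
  have hp0 : φ.prodFun φ.pt = (0, 0) := by
    rw [ImplicitFunctionData.prodFun_apply, hpt, hleft, h0, hr0]
  let G := φ.implicitFunction.uncurry
  have hG : ContDiffAt ℝ 1 G (0, 0) := by
    have := φ.contDiffAt_implicitFunction (n := 1) hΦ hright.contDiffAt one_ne_zero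
    rwa [hp0] at this
  have hG0 : G (0, 0) = (v, 0) := by
    have := φ.implicitFunction_apply_image.self_of_nhds
    rwa [hpt, hleft, h0, hr0] at this
  have hΦd : ∀ᶠ z in 𝓝 (v, (0 : ℝ)), DifferentiableAt ℝ Φ z :=
    (hΦ.eventually (by simp)).mono fun z hz => hz.differentiableAt one_ne_zero
  have hGt : Tendsto G (𝓝 (0, 0)) (𝓝 (v, 0)) := by
    have := hG.continuousAt.tendsto
    rwa [hG0] at this
  have hall : ∀ᶠ p in 𝓝 ((0 : V), (0 : (fderiv ℝ Φ (v, 0)).ker)), DifferentiableAt ℝ G p ∧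
      Φ (G p) = p.1 ∧ DifferentiableAt ℝ Φ (G p) ∧
      (Φ (G p) = 0 → ∀ ζ, fderiv ℝ Φ (G p) ζ = 0 → ζ.2 = 0) := by
    have h1 := φ.leftFun_implicitFunction
    rw [hp0] at h1
    filter_upwards [(hG.eventually (by simp)).mono fun z hz => hz.differentiableAt one_ne_zero, h1,
      hGt.eventually hΦd, hGt.eventually hker] with p a b c d using ⟨a, b, c, d⟩
  have hincl : Tendsto (fun k : (fderiv ℝ Φ (v, 0)).ker => ((0 : V), k)) (𝓝 0) (𝓝 (0, 0)) :=
    Continuous.tendsto (by fun_prop) 0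
  obtain ⟨ρ, hρ, hball⟩ := Metric.eventually_nhds_iff_ball.1 (hincl.eventually hall)
  -- `G (0, ·)` parametrizes the zero set near `(v, 0)` by the kernel of the differential; the
  -- derivative of its last coordinate is zero on a ball.
  have hconst : ∀ k ∈ Metric.ball (0 : (fderiv ℝ Φ (v, 0)).ker) ρ, (G (0, k)).2 = 0 := by
    have hd : ∀ k ∈ Metric.ball (0 : (fderiv ℝ Φ (v, 0)).ker) ρ,
        HasFDerivAt (fun k => (G (0, k)).2) (0 : (fderiv ℝ Φ (v, 0)).ker →L[ℝ] ℝ) k := by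
      intro k hk
      obtain ⟨h1, h2, h3, h4⟩ := hball k hk
      have hin : HasFDerivAt (fun k : (fderiv ℝ Φ (v, 0)).ker => ((0 : V), k))
          (ContinuousLinearMap.inr ℝ V _) k := (hasFDerivAt_const _ _).prodMk (hasFDerivAt_id _)
      have hGk := h1.hasFDerivAt.comp k hin
      set D := (fderiv ℝ G (0, k)).comp (ContinuousLinearMap.inr ℝ V _)
      -- `Φ ∘ G (0, ·)` vanishes identically, so the derivative `D` takes values in the kernel of
      -- the differential of `Φ`, where `hker` applies.
      have hzero : HasFDerivAt (fun _ : (fderiv ℝ Φ (v, 0)).ker => (0 : V))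
          ((fderiv ℝ Φ (G (0, k))).comp D) k := by
        refine (h3.hasFDerivAt.comp k hGk).congr_of_eventuallyEq ?_
        filter_upwards [Metric.isOpen_ball.mem_nhds hk] with k' hk'
        exact (hball k' hk').2.1.symm
      have hz := hzero.unique (hasFDerivAt_const _ _)
      have := hGk.snd
      convert! this using 1
      ext ξ
      exact (h4 h2 (D ξ) (DFunLike.congr_fun hz ξ)).symm
    intro k hk
    have := Metric.isOpen_ball.is_const_of_fderiv_eq_zero
      (convex_ball (0 : (fderiv ℝ Φ (v, 0)).ker) ρ).isPreconnected
      (fun k hk => (hd k hk).differentiableAt.differentiableWithinAt) (fun k hk => (hd k hk).fderiv)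
      hk (Metric.mem_ball_self hρ)
    rw [this, hG0]
  have hrt : Tendsto φ.rightFun (𝓝 (v, 0)) (𝓝 0) := by
    have := hright.continuous.tendsto (v, 0)
    rwa [hr0] at this
  filter_upwards [φ.implicitFunction_apply_image, hrt.eventually (Metric.ball_mem_nhds 0 hρ)]
    with z h1 h2 h3
  have := hconst _ h2
  rw [hleft, h3] at h1
  rw [← h1]
  exact this

/-- A proper subspace of `X × ℝ` is annihilated by a functional of norm one. -/
theorem exists_unit_functional [FiniteDimensional ℝ V] {p : Submodule ℝ (V × ℝ)} (hp : p ≠ ⊤) :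
    ∃ q : (V →L[ℝ] ℝ) × ℝ, ‖q‖ = 1 ∧ ∀ z ∈ p, q.1 z.1 + q.2 * z.2 = 0 := by
  obtain ⟨φ, hφ, hle⟩ := p.exists_le_ker_of_lt_top (lt_top_iff_ne_top.2 hp)
  let q : (V →L[ℝ] ℝ) × ℝ := ((φ.comp (LinearMap.inl ℝ V ℝ)).toContinuousLinearMap, φ (0, 1))
  have hq : ∀ z : V × ℝ, q.1 z.1 + q.2 * z.2 = φ z := fun z => by
    have : z = (z.1, 0) + z.2 • ((0 : V), (1 : ℝ)) := by simp
    conv_rhs => rw [this]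
    rw [map_add, map_smul, smul_eq_mul, mul_comm]
    rfl
  have hq0 : q ≠ 0 := by
    rintro h
    refine hφ (LinearMap.ext fun z => ?_)
    rw [← hq, h]; simp
  refine ⟨‖q‖⁻¹ • q, ?_, fun z hz => ?_⟩
  · rw [norm_smul, norm_inv, norm_norm, inv_mul_cancel₀ (norm_ne_zero_iff.2 hq0)]
  · have : φ z = 0 := hle hz
    rw [← hq] at this
    simp only [Prod.smul_fst, Prod.smul_snd, smul_apply, smul_eq_mul, mul_assoc,
      ← mul_add, this, mul_zero]

end Calculus

/-! ### From estimates on velocities to tangency of strata -/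

section Strata

variable {V : Type*} [NormedAddCommGroup V] [NormedSpace ℝ V]

theorem tangentVectors_mono {N Z : Set V} (h : N ⊆ Z) (Q : V) :
    tangentVectors N Q ⊆ tangentVectors Z Q := by
  rintro w ⟨γ, δ, hδ, hγ, hN, h0, hw⟩
  exact ⟨γ, δ, hδ, hγ, fun t ht => h (hN t ht), h0, hw⟩

/-- An estimate on velocities of curves in all of `Z` restricts to every subset `N`. It also gives
the condition on curves: by translation in time, `γ'(τ)` is itself a velocity of `Z` at `γ(τ)`, and
the estimate passes to the limit since `H` is closed. -/
theorem stratumTangentAt_of_eventually [FiniteDimensional ℝ V] {Z N : Set V} {P : V}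
    {H : Submodule ℝ V} (hN : N ⊆ Z)
    (h : ∀ ε > 0, ∀ᶠ Q in 𝓝[Z] P, ∀ w ∈ tangentVectors Z Q,
      Metric.infDist w (H : Set V) ≤ ε * ‖w‖) : StratumTangentAt Z N P H := by
  refine ⟨fun ε hε => ?_, fun γ w hγ hZ hP hw => ?_⟩
  · filter_upwards [(h ε hε).filter_mono (nhdsWithin_mono P hN)] with Q hQ w hw
    exact hQ w (tangentVectors_mono hN Q hw)
  · have hIoo : Ioo (0 : ℝ) 1 ∈ 𝓝[>] (0 : ℝ) := Ioo_mem_nhdsGT one_pos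
    have hPZ : Tendsto γ (𝓝[>] 0) (𝓝[Z] P) := tendsto_nhdsWithin_iff.2
      ⟨hP, mem_of_superset hIoo fun τ hτ => (hZ τ hτ).2⟩
    have htan : ∀ τ ∈ Ioo (0 : ℝ) 1, deriv γ τ ∈ tangentVectors Z (γ τ) := fun τ hτ => by
      have hmem : ∀ t ∈ Ioo (-(min τ (1 - τ))) (min τ (1 - τ)), τ + t ∈ Ioo (0 : ℝ) 1 :=
        fun t ht => ⟨by linarith [ht.1, min_le_left τ (1 - τ)],
          by linarith [ht.2, min_le_right τ (1 - τ)]⟩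
      refine ⟨fun t => γ (τ + t), min τ (1 - τ), lt_min hτ.1 (by linarith [hτ.2]), ?_,
        fun t ht => (hZ _ (hmem t ht)).2, by simp, ?_⟩
      · exact hγ.comp (by fun_prop) hmem
      · rw [deriv_comp_const_add, add_zero]
    have hinf : Metric.infDist w (H : Set V) ≤ 0 := by
      refine le_of_forall_pos_le_add fun ε hε => ?_
      have h1 : Tendsto (fun τ => Metric.infDist (deriv γ τ) (H : Set V)) (𝓝[>] 0)
          (𝓝 (Metric.infDist w (H : Set V))) :=
        (Metric.continuous_infDist_pt _).continuousAt.tendsto.comp hw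
      have h2 := hw.norm.const_mul (ε / (‖w‖ + 1))
      have h3 : ∀ᶠ τ in 𝓝[>] (0 : ℝ), Metric.infDist (deriv γ τ) (H : Set V) ≤
          ε / (‖w‖ + 1) * ‖deriv γ τ‖ := by
        filter_upwards [hPZ.eventually (h (ε / (‖w‖ + 1)) (by positivity)), hIoo] with τ h4 h5
        exact h4 _ (htan τ h5)
      refine (le_of_tendsto_of_tendsto h1 h2 h3).trans ?_
      rw [zero_add, div_mul_eq_mul_div, div_le_iff₀ (by positivity)]
      nlinarith [norm_nonneg w]
    have hcl : IsClosed (H : Set V) := H.closed_of_finiteDimensional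
    exact (hcl.mem_iff_infDist_zero ⟨0, H.zero_mem⟩).2 (le_antisymm hinf Metric.infDist_nonneg)

/-- Subtracting the multiple of a fixed `z` outside `ker q` that cancels `q w` moves `w` into `ker
q`, hence into `H`. This converts smallness of a covector on `w` into closeness to the hyperplane.
-/
theorem exists_infDist_le_abs {q : V → ℝ} (hq : IsLinearMap ℝ q) (hq0 : ∃ z, q z ≠ 0)
    {H : Submodule ℝ V} (hH : ∀ z, q z = 0 → z ∈ H) :
    ∃ C > 0, ∀ w, Metric.infDist w (H : Set V) ≤ C * |q w| := by
  obtain ⟨z, hz⟩ := hq0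
  refine ⟨|q z|⁻¹ * ‖z‖ + 1, by positivity, fun w => ?_⟩
  have hmem : w - (q w / q z) • z ∈ H := hH _ (by
    rw [hq.map_sub, hq.map_smul, smul_eq_mul, div_mul_cancel₀ _ hz, sub_self])
  refine (Metric.infDist_le_dist_of_mem hmem).trans ?_
  rw [dist_eq_norm, sub_sub_cancel, norm_smul, norm_div, Real.norm_eq_abs, Real.norm_eq_abs]
  have := abs_nonneg (q w)
  calc |q w| / |q z| * ‖z‖ = (|q z|⁻¹ * ‖z‖) * |q w| := by ring
    _ ≤ _ := by nlinarith

end Strata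
end

noncomputable section

/-! ### The cost as a squared norm, and the extended end-point map -/

section Cost

variable {m : ℕ} {T : ℝ}

theorem cost_eq_norm_sq (hT : 0 ≤ T) (u : Control T m) : cost T u = ‖u‖ ^ 2 := by
  rw [← real_inner_self_eq_norm_sq, L2.inner_def, cost, intervalIntegral.integral_of_le hT,
    integral_Icc_eq_integral_Ioc]
  refine integral_congr_ae (Eventually.of_forall fun s => ?_)
  simp [EuclideanSpace.norm_sq_eq]

theorem hasStrictFDerivAt_cost (hT : 0 ≤ T) (u : Control T m) :
    HasStrictFDerivAt (cost T) (2 • innerSL ℝ u) u := by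
  rw [show (cost T : Control T m → ℝ) = fun u => ‖u‖ ^ 2 from funext (cost_eq_norm_sq hT)]
  exact hasStrictFDerivAt_norm_sq u

theorem fderiv_cost_apply (hT : 0 ≤ T) (u ξ : Control T m) :
    fderiv ℝ (cost T) u ξ = 2 * inner ℝ u ξ := by
  rw [(hasStrictFDerivAt_cost hT u).hasFDerivAt.fderiv]
  simp

theorem contDiff_cost (hT : 0 ≤ T) : ContDiff ℝ 1 (cost T : Control T m → ℝ) := by
  rw [show (cost T : Control T m → ℝ) = fun u => ‖u‖ ^ 2 from funext (cost_eq_norm_sq hT)]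
  exact contDiff_norm_sq ℝ

/-- Weak lower semicontinuity of the squared norm, from `⟪v₀, v⟫ ≤ (‖v₀‖² + ‖v‖²) / 2`. -/
theorem cost_le_of_weakTendsto (hT : 0 ≤ T) {α : Type*} {l : Filter α} [l.NeBot]
    {v : α → Control T m} {v₀ : Control T m} (hv : WeakTendsto v l v₀) {s : ℝ}
    (hs : Tendsto (fun k => cost T (v k)) l (𝓝 s)) : cost T v₀ ≤ s := by
  have h1 : Tendsto (fun k => inner ℝ v₀ (v k)) l (𝓝 (inner ℝ v₀ v₀)) := hv.2 (innerSL ℝ v₀)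
  have h2 := (hs.const_add (cost T v₀)).div_const 2
  have h3 : ∀ k, inner ℝ v₀ (v k) ≤ (cost T v₀ + cost T (v k)) / 2 := fun k => by
    have := real_inner_le_norm v₀ (v k)
    rw [cost_eq_norm_sq hT, cost_eq_norm_sq hT]
    nlinarith [sq_nonneg (‖v₀‖ - ‖v k‖)]
  have h4 := le_of_tendsto_of_tendsto' h1 h2 h3
  rw [real_inner_self_eq_norm_sq, ← cost_eq_norm_sq hT] at h4
  linarith

/-- In a Hilbert space, weak convergence with convergence of norms is strong: expand `‖v k - v₀‖²`.
-/
theorem tendsto_of_weakTendsto_of_cost (hT : 0 ≤ T) {α : Type*} {l : Filter α}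
    {v : α → Control T m} {v₀ : Control T m} (hv : WeakTendsto v l v₀)
    (hs : Tendsto (fun k => cost T (v k)) l (𝓝 (cost T v₀))) : Tendsto v l (𝓝 v₀) := by
  rw [tendsto_iff_norm_sub_tendsto_zero]
  have h1 : Tendsto (fun k => inner ℝ v₀ (v k)) l (𝓝 (inner ℝ v₀ v₀)) := hv.2 (innerSL ℝ v₀)
  have h2 : Tendsto (fun k => ‖v k - v₀‖ ^ 2) l (𝓝 0) := by
    have h3 := (hs.sub (h1.const_mul 2)).add_const (cost T v₀)
    have e : cost T v₀ - 2 * inner ℝ v₀ v₀ + cost T v₀ = 0 := by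
      rw [real_inner_self_eq_norm_sq, ← cost_eq_norm_sq hT]; ring
    rw [e] at h3
    refine h3.congr fun k => ?_
    rw [norm_sub_sq_real, cost_eq_norm_sq hT, cost_eq_norm_sq hT, real_inner_comm]
  simpa [Real.sqrt_sq] using h2.sqrt

end Cost

section Extended

variable {X : Type*} [NormedAddCommGroup X] [NormedSpace ℝ X] [FiniteDimensional ℝ X] {m : ℕ}
  {T : ℝ} {f₀ : X → X} {f : Fin m → X → X}

theorem intervalIntegrable_sum_sq (u : Control T m) {t : ℝ} (ht : t ∈ Icc 0 T) :
    IntervalIntegrable (fun s => ∑ i, (u s i) ^ 2) volume 0 t := by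
  have h1 : Integrable (fun s => ‖u s‖ ^ 2) (volume.restrict (Icc 0 T)) :=
    (memLp_two_iff_integrable_sq_norm (Lp.aestronglyMeasurable u)).1 (Lp.memLp u)
  rw [intervalIntegrable_iff]
  refine IntegrableOn.mono_set (t := Icc 0 T) ?_
    (uIoc_subset_uIcc.trans (uIcc_subset_Icc ⟨le_rfl, ht.1.trans ht.2⟩ ht))
  simpa [EuclideanSpace.norm_sq_eq, IntegrableOn] using h1

theorem IsTrajectory.extended {F : X → EuclideanSpace ℝ (Fin m) → X} (hT : 0 ≤ T)
    {u : Control T m} {x : ℝ → X} (hx : IsTrajectory F T u x) :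
    IsTrajectory (extendedField F) T u
      (fun t => (x t, ∫ s in (0 : ℝ)..t, ∑ i, (u s i) ^ 2)) := by
  have : CompleteSpace X := FiniteDimensional.complete ℝ X
  have h0 : (0 : ℝ) ∈ Icc 0 T := ⟨le_rfl, hT⟩
  have hint : ∀ t ∈ Icc (0 : ℝ) T, IntervalIntegrable (fun s => (F (x s) (u s),
      ∑ i, (u s i) ^ 2)) volume 0 t := fun t ht => by
    have h1 : IntervalIntegrable (fun s => F (x s) (u s)) volume 0 t := hx.2.1.mono_set (by
      rw [uIcc_of_le ht.1, uIcc_of_le hT]; exact Icc_subset_Icc_right ht.2)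
    have h2 := intervalIntegrable_sum_sq u ht
    exact ⟨h1.1.prodMk h2.1, h1.2.prodMk h2.2⟩
  refine ⟨hx.1.prodMk ?_, hint T ⟨hT, le_rfl⟩, fun t ht => ?_⟩
  · have h1 := intervalIntegral.continuousOn_primitive_interval' (a := 0)
      (intervalIntegrable_sum_sq u ⟨hT, le_rfl⟩) (by simp)
    rwa [uIcc_of_le hT] at h1
  · refine Prod.ext ?_ ?_
    · exact (hx.2.2 t ht).trans ((ContinuousLinearMap.fst ℝ X ℝ).intervalIntegral_comp_comm
        (hint t ht))
    · exact (ContinuousLinearMap.snd ℝ X ℝ).intervalIntegral_comp_comm (hint t ht)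

theorem IsTrajectory.of_extended {F : X → EuclideanSpace ℝ (Fin m) → X} (hT : 0 ≤ T)
    {u : Control T m} {z : ℝ → X × ℝ} (hz : IsTrajectory (extendedField F) T u z) :
    IsTrajectory F T u (fun t => (z t).1) ∧ (z T).2 = cost T u := by
  have : CompleteSpace X := FiniteDimensional.complete ℝ X
  have hint : ∀ t ∈ Icc (0 : ℝ) T, IntervalIntegrable (fun s => extendedField F (z s) (u s))
      volume 0 t := fun t ht => hz.2.1.mono_set (by
    rw [uIcc_of_le ht.1, uIcc_of_le hT]; exact Icc_subset_Icc_right ht.2)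
  have hTT : T ∈ Icc (0 : ℝ) T := ⟨hT, le_rfl⟩
  refine ⟨⟨hz.1.fst, ⟨(hint T hTT).1.fst, (hint T hTT).2.fst⟩, fun t ht => ?_⟩, ?_⟩
  · exact (congrArg Prod.fst (hz.2.2 t ht)).trans
      ((ContinuousLinearMap.fst ℝ X ℝ).intervalIntegral_comp_comm (hint t ht)).symm
  · exact (congrArg Prod.snd (hz.2.2 T hTT)).trans
      ((ContinuousLinearMap.snd ℝ X ℝ).intervalIntegral_comp_comm (hint T hTT)).symm

theorem endpoint_extendedField (hT : 0 ≤ T) (hf₀ : ContDiff ℝ 2 f₀) (hf : ∀ i, ContDiff ℝ 2 (f i))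
    {u : Control T m} (hu : u ∈ admissible (affineField f₀ f) T) :
    endpoint (extendedField (affineField f₀ f)) T u =
      (endpoint (affineField f₀ f) T u, cost T u) := by
  obtain ⟨x, hx⟩ := hu
  have h : ∃ z, IsTrajectory (extendedField (affineField f₀ f)) T u z := ⟨_, hx.extended hT⟩
  rw [endpoint, dif_pos h]
  obtain ⟨h1, h2⟩ := h.choose_spec.of_extended hT
  refine Prod.ext ?_ h2
  exact (endpoint_eq hT hf₀ hf
    ((isTrajectory_iff hT hf₀.continuous fun i => (hf i).continuous).1 h1)).symm

/-- The differential of the endpoint map of the extended system. -/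
def extendedDifferential (F : X → EuclideanSpace ℝ (Fin m) → X) (T : ℝ) (u : Control T m) :
    Control T m →L[ℝ] X × ℝ :=
  (fderiv ℝ (endpoint F T) u).prod (fderiv ℝ (cost T) u)

theorem hasStrictFDerivAt_endpoint_prod (hT : 0 ≤ T) (hf₀ : ContDiff ℝ 2 f₀)
    (hf : ∀ i, ContDiff ℝ 2 (f i)) {u : Control T m} (hu : u ∈ admissible (affineField f₀ f) T) :
    HasStrictFDerivAt (fun v => (endpoint (affineField f₀ f) T v, cost T v))
      (extendedDifferential (affineField f₀ f) T u) u := by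
  refine (exists_hasStrictFDerivAt_endpoint hT hf₀ hf hu).1.prodMk ?_
  have h := hasStrictFDerivAt_cost hT u
  rwa [h.hasFDerivAt.fderiv]

theorem hasFDerivAt_endpoint_extendedField (hT : 0 ≤ T) (hf₀ : ContDiff ℝ 2 f₀)
    (hf : ∀ i, ContDiff ℝ 2 (f i)) {u : Control T m} (hu : u ∈ admissible (affineField f₀ f) T) :
    HasFDerivAt (endpoint (extendedField (affineField f₀ f)) T)
      (extendedDifferential (affineField f₀ f) T u) u := by
  refine (hasStrictFDerivAt_endpoint_prod hT hf₀ hf hu).hasFDerivAt.congr_of_eventuallyEq ?_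
  filter_upwards [(isOpen_admissible hT hf₀ hf).mem_nhds hu] with v hv
  exact endpoint_extendedField hT hf₀ hf hv

end Extended

/-! ### Minimizing controls and their Lagrange multipliers -/

section Minimizers

variable {X : Type*} [NormedAddCommGroup X] [NormedSpace ℝ X] {m : ℕ}
  {T : ℝ} {f₀ : X → X} {f : Fin m → X → X}

theorem valueFunction_le_cost {F : X → EuclideanSpace ℝ (Fin m) → X} {v : Control T m}
    (hv : v ∈ admissible F T) : valueFunction F T (endpoint F T v) ≤ cost T v :=
  iInf₂_le v (show v ∈ {w : Control T m | w ∈ admissible F T ∧ endpoint F T w = endpoint F T v}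
    from ⟨hv, rfl⟩)

theorem IsMinimizing.valueFunction_eq {F : X → EuclideanSpace ℝ (Fin m) → X} {v : Control T m}
    (hv : IsMinimizing F T v) : valueFunction F T (endpoint F T v) = cost T v :=
  le_antisymm (valueFunction_le_cost hv.1) (le_iInf₂ fun w hw =>
    EReal.coe_le_coe_iff.2 (hv.2 w hw.1 hw.2))

theorem isMinimizing_of_cost_le {F : X → EuclideanSpace ℝ (Fin m) → X} {v : Control T m}
    (hv : v ∈ admissible F T) {x : X} {s : ℝ} (hS : valueFunction F T x = s)
    (hx : endpoint F T v = x) (hs : cost T v ≤ s) : IsMinimizing F T v := by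
  refine ⟨hv, fun w hw hwv => hs.trans ?_⟩
  have := valueFunction_le_cost hw
  rw [hwv, hx, hS] at this
  exact EReal.coe_le_coe_iff.1 this

theorem mem_multipliers_iff (hT : 0 ≤ T) {F : X → EuclideanSpace ℝ (Fin m) → X} {u : Control T m}
    {q : (X →L[ℝ] ℝ) × ℝ} : q ∈ multipliers F T u ↔
      ∀ ξ, q.1 (fderiv ℝ (endpoint F T) u ξ) + q.2 * (2 * inner ℝ u ξ) = 0 := by
  change q.1.comp (fderiv ℝ (endpoint F T) u) = -q.2 • fderiv ℝ (cost T) u ↔ _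
  rw [ContinuousLinearMap.ext_iff]
  refine forall_congr' fun ξ => ?_
  rw [ContinuousLinearMap.comp_apply, smul_apply, fderiv_cost_apply hT, smul_eq_mul, neg_mul,
    eq_neg_iff_add_eq_zero]

theorem mem_multipliers_of_range (hT : 0 ≤ T) {F : X → EuclideanSpace ℝ (Fin m) → X}
    {u : Control T m} {q : (X →L[ℝ] ℝ) × ℝ}
    (hq : ∀ z ∈ (extendedDifferential F T u).range, q.1 z.1 + q.2 * z.2 = 0) :
    q ∈ multipliers F T u :=
  (mem_multipliers_iff hT).2 fun ξ => by
    have := hq (extendedDifferential F T u ξ) ⟨ξ, rfl⟩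
    rw [← fderiv_cost_apply hT]
    exact this

variable [FiniteDimensional ℝ X]

/-- Weak compactness of the set of controls of bounded cost. -/
theorem exists_weak_limit (hT : 0 ≤ T) (hf₀ : ContDiff ℝ 2 f₀) (hf : ∀ i, ContDiff ℝ 2 (f i))
    {r : ℝ} (hadm : ∀ v : Control T m, cost T v ≤ r → v ∈ admissible (affineField f₀ f) T)
    {α : Type*} (g : Ultrafilter α) {v : α → Control T m} {x : X} {s : ℝ} (hsr : s ≤ r)
    (hx : Tendsto (fun k => endpoint (affineField f₀ f) T (v k)) g (𝓝 x))
    (hs : Tendsto (fun k => cost T (v k)) g (𝓝 s)) :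
    ∃ v₀, WeakTendsto v g v₀ ∧ v₀ ∈ admissible (affineField f₀ f) T ∧
      endpoint (affineField f₀ f) T v₀ = x ∧ cost T v₀ ≤ s := by
  -- The bound comes from `‖v k‖² < s + 1` and `2 ‖v k‖ ≤ ‖v k‖² + 1`.
  have hb : ∀ᶠ k in (g : Filter α), ‖v k‖ ≤ s + 2 := by
    filter_upwards [hs.eventually_lt_const (lt_add_one s)] with k hk
    rw [cost_eq_norm_sq hT] at hk
    nlinarith [sq_nonneg (‖v k‖ - 1), norm_nonneg (v k)]
  obtain ⟨v₀, hv₀, -⟩ := exists_weakTendsto g hb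
  have hc := cost_le_of_weakTendsto hT hv₀ hs
  have hadm₀ := hadm v₀ (hc.trans hsr)
  exact ⟨v₀, hv₀, hadm₀, tendsto_nhds_unique (hv₀.tendsto_endpoint hT hf₀ hf hadm₀).2 hx, hc⟩

/-- The direct method: a minimizing sequence has a weak limit with the same end-point, and lower
semicontinuity bounds its cost by `s`. -/
theorem exists_minimizer (hT : 0 ≤ T) (hf₀ : ContDiff ℝ 2 f₀) (hf : ∀ i, ContDiff ℝ 2 (f i))
    {r : ℝ} (hadm : ∀ v : Control T m, cost T v ≤ r → v ∈ admissible (affineField f₀ f) T)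
    {x : X} {s : ℝ} (hS : valueFunction (affineField f₀ f) T x = s) (hsr : s ≤ r) :
    ∃ v, v ∈ admissible (affineField f₀ f) T ∧ endpoint (affineField f₀ f) T v = x ∧
      cost T v = s := by
  have hex : ∀ k : ℕ, ∃ v : Control T m, v ∈ admissible (affineField f₀ f) T ∧
      endpoint (affineField f₀ f) T v = x ∧ cost T v < s + 1 / (k + 1) := fun k => by
    have hlt : valueFunction (affineField f₀ f) T x < ((s + 1 / (k + 1) : ℝ) : EReal) := by
      rw [hS, EReal.coe_lt_coe_iff]
      have : (0 : ℝ) < 1 / (k + 1) := by positivity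
      linarith
    simp only [valueFunction, iInf_lt_iff] at hlt
    obtain ⟨v, hv, hlt⟩ := hlt
    exact ⟨v, hv.1, hv.2, EReal.coe_lt_coe_iff.1 hlt⟩
  choose v hv1 hv2 hv3 using hex
  have hge : ∀ w ∈ admissible (affineField f₀ f) T, endpoint (affineField f₀ f) T w = x →
      s ≤ cost T w := fun w hw hwx => by
    have := valueFunction_le_cost hw
    rw [hwx, hS] at this
    exact EReal.coe_le_coe_iff.1 this
  have hlim : Tendsto (fun k => cost T (v k)) (hyperfilter ℕ) (𝓝 s) := by
    have h1 : Tendsto (fun k => cost T (v k)) atTop (𝓝 s) := by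
      refine tendsto_of_tendsto_of_tendsto_of_le_of_le tendsto_const_nhds
        (h := fun k : ℕ => s + 1 / ((k : ℝ) + 1)) ?_ (fun k => hge _ (hv1 k) (hv2 k))
        (fun k => (hv3 k).le)
      simpa using tendsto_one_div_add_atTop_nhds_zero_nat.const_add s
    exact h1.mono_left (Nat.hyperfilter_le_atTop)
  obtain ⟨w, -, hw1, hw2, hw3⟩ := exists_weak_limit hT hf₀ hf hadm (hyperfilter ℕ) hsr
    (tendsto_const_nhds.congr fun k => (hv2 k).symm) hlim
  exact ⟨w, hw1, hw2, le_antisymm hw3 (hge w hw1 hw2)⟩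

/-- If `dE~` were onto, `E~` would be open at `v` and some control would reach the same point at
strictly smaller cost. -/
theorem IsMinimizing.not_surjective (hT : 0 ≤ T) (hf₀ : ContDiff ℝ 2 f₀)
    (hf : ∀ i, ContDiff ℝ 2 (f i)) {v : Control T m} (hv : IsMinimizing (affineField f₀ f) T v) :
    ¬ Function.Surjective (extendedDifferential (affineField f₀ f) T v) := by
  intro hsurj
  have : CompleteSpace X := FiniteDimensional.complete ℝ X
  have hmap := (hasStrictFDerivAt_endpoint_prod hT hf₀ hf hv.1).map_nhds_eq_of_surj
    (LinearMap.range_eq_top.2 hsurj)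
  have himg : (fun v => (endpoint (affineField f₀ f) T v, cost T v)) ''
      admissible (affineField f₀ f) T ∈ 𝓝 (endpoint (affineField f₀ f) T v, cost T v) := by
    rw [← hmap]
    exact image_mem_map ((isOpen_admissible hT hf₀ hf).mem_nhds hv.1)
  have hcurve : Tendsto (fun ε : ℝ => (endpoint (affineField f₀ f) T v, cost T v - ε)) (𝓝[>] 0)
      (𝓝 (endpoint (affineField f₀ f) T v, cost T v)) := by
    refine Tendsto.mono_left ?_ nhdsWithin_le_nhds
    have : Continuous fun ε : ℝ => (endpoint (affineField f₀ f) T v, cost T v - ε) := by fun_prop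
    simpa using this.tendsto 0
  obtain ⟨ε, ⟨w, hw, hwε⟩, hε⟩ := ((hcurve.eventually himg).and self_mem_nhdsWithin).exists
  have h1 := hv.2 w hw (congrArg Prod.fst hwε)
  have h2 : cost T w = cost T v - ε := congrArg Prod.snd hwε
  have h3 : (0 : ℝ) < ε := hε
  linarith

/-- Every vector tangent to the graph of the value function is annihilated by a Lagrange
multiplier of a minimizing control. -/
theorem exists_multiplier_annihilating (hT : 0 ≤ T) (hf₀ : ContDiff ℝ 2 f₀)
    (hf : ∀ i, ContDiff ℝ 2 (f i)) {r : ℝ}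
    (hadm : ∀ v : Control T m, cost T v ≤ r → v ∈ admissible (affineField f₀ f) T)
    {Q w : X × ℝ} (hw : w ∈ tangentVectors (augmentedSublevelSet (affineField f₀ f) T r) Q) :
    ∃ v, v ∈ admissible (affineField f₀ f) T ∧ endpoint (affineField f₀ f) T v = Q.1 ∧
      cost T v = Q.2 ∧ ∃ q ∈ multipliers (affineField f₀ f) T v, ‖q‖ = 1 ∧
        q.1 w.1 + q.2 * w.2 = 0 := by
  obtain ⟨γ, δ, hδ, hγ, hγZ, h0, hw⟩ := hw
  have hle : ∀ y ∈ augmentedSublevelSet (affineField f₀ f) T r, y.2 ≤ r := fun y hy =>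
    EReal.coe_le_coe_iff.1 (hy.2 ▸ hy.1)
  have h0δ : (0 : ℝ) ∈ Ioo (-δ) δ := ⟨by linarith, hδ⟩
  have hnhds : Ioo (-δ) δ ∈ 𝓝 (0 : ℝ) := isOpen_Ioo.mem_nhds h0δ
  have hγc : ∀ t ∈ Ioo (-δ) δ, ContDiffAt ℝ 1 γ t := fun t ht =>
    hγ.contDiffAt (isOpen_Ioo.mem_nhds ht)
  have hex : ∀ t ∈ Ioo (-δ) δ, ∃ v : Control T m, v ∈ admissible (affineField f₀ f) T ∧
      endpoint (affineField f₀ f) T v = (γ t).1 ∧ cost T v = (γ t).2 := fun t ht =>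
    exists_minimizer hT hf₀ hf hadm (hγZ t ht).2 (hle _ (hγZ t ht))
  choose! v hv using hex
  have hQ : Q ∈ augmentedSublevelSet (affineField f₀ f) T r := h0 ▸ hγZ 0 h0δ
  -- The ultrafilter avoids `t = 0`: the contradiction needs zeros of `Φ` with nonzero time.
  obtain ⟨g, hg⟩ : ∃ g : Ultrafilter ℝ, (g : Filter ℝ) ≤ 𝓝[≠] 0 := ⟨_, Ultrafilter.of_le _⟩
  have hg' : (g : Filter ℝ) ≤ 𝓝 0 := hg.trans nhdsWithin_le_nhds
  have hγt : Tendsto γ g (𝓝 Q) := by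
    have := (hγc 0 h0δ).continuousAt.tendsto.mono_left hg'
    rwa [h0] at this
  have hgδ : ∀ᶠ t in (g : Filter ℝ), t ∈ Ioo (-δ) δ := hg' hnhds
  have hcost : Tendsto (fun t => cost T (v t)) g (𝓝 Q.2) :=
    ((continuous_snd.tendsto Q).comp hγt).congr' (hgδ.mono fun t ht => (hv t ht).2.2.symm)
  obtain ⟨v₀, hv₀, hv₀a, hv₀e, hv₀c⟩ := exists_weak_limit hT hf₀ hf hadm g (hle Q hQ)
    (((continuous_fst.tendsto Q).comp hγt).congr' (hgδ.mono fun t ht => (hv t ht).2.1.symm)) hcost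
  have hmin := isMinimizing_of_cost_le hv₀a hQ.2 hv₀e hv₀c
  have hv₀c' : cost T v₀ = Q.2 := by
    have := hmin.valueFunction_eq
    rw [hv₀e, hQ.2] at this
    exact (EReal.coe_eq_coe_iff.1 this).symm
  refine ⟨v₀, hv₀a, hv₀e, hv₀c', ?_⟩
  -- If the sum is a proper subspace, a unit functional annihilating it is a multiplier that kills
  -- `w`. The other case is contradictory.
  by_cases htop : (extendedDifferential (affineField f₀ f) T v₀).range ⊔ Submodule.span ℝ {w} = ⊤
  swap
  · obtain ⟨q, hq1, hq⟩ := exists_unit_functional htop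
    exact ⟨q, mem_multipliers_of_range hT fun z hz => hq z (Submodule.mem_sup_left hz), hq1,
      hq w (Submodule.mem_sup_right (Submodule.mem_span_singleton_self w))⟩
  exfalso
  -- Strong convergence is essential here: the submersion argument only controls norm neighbourhoods
  -- of `v₀`.
  have hvt : Tendsto v g (𝓝 v₀) := tendsto_of_weakTendsto_of_cost hT hv₀ (by rwa [hv₀c'])
  let Φ : Control T m × ℝ → X × ℝ := fun z =>
    (endpoint (affineField f₀ f) T z.1, cost T z.1) - γ z.2
  have hΦd : ∀ z : Control T m × ℝ, z.1 ∈ admissible (affineField f₀ f) T → z.2 ∈ Ioo (-δ) δ →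
      HasFDerivAt Φ ((extendedDifferential (affineField f₀ f) T z.1).comp
        (ContinuousLinearMap.fst ℝ _ ℝ) - (ContinuousLinearMap.snd ℝ (Control T m) ℝ).smulRight
          (deriv γ z.2)) z := fun z h1 h2 => by
    have h3 := (hasStrictFDerivAt_endpoint_prod hT hf₀ hf h1).hasFDerivAt.comp z
      (hasFDerivAt_fst (𝕜 := ℝ) (p := z))
    have h4 := ((hγc z.2 h2).differentiableAt one_ne_zero).hasDerivAt.hasFDerivAt.comp z
      (hasFDerivAt_snd (𝕜 := ℝ) (p := z))
    refine (h3.sub h4).congr_fderiv ?_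
    ext ξ <;> simp
  have hΦ : ContDiffAt ℝ 1 Φ (v₀, 0) := by
    have h1 : ContDiffAt ℝ 1 (fun v => (endpoint (affineField f₀ f) T v, cost T v)) v₀ :=
      (contDiffAt_endpoint hT hf₀ hf hv₀a).prodMk (contDiff_cost hT).contDiffAt
    exact (h1.comp (v₀, (0 : ℝ)) contDiffAt_fst).sub ((hγc 0 h0δ).comp (v₀, (0 : ℝ)) contDiffAt_snd)
  have hΦ0 : Φ (v₀, 0) = 0 := by
    simp only [Φ, h0, hv₀e, hv₀c', Prod.mk.eta, sub_self]
  have hsurj : Function.Surjective (fderiv ℝ Φ (v₀, 0)) := by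
    rw [(hΦd (v₀, 0) hv₀a h0δ).fderiv]
    intro y
    have hy : y ∈ (extendedDifferential (affineField f₀ f) T v₀).range ⊔ Submodule.span ℝ {w} :=
      htop ▸ Submodule.mem_top
    obtain ⟨_, ⟨ξ, rfl⟩, b, hb, rfl⟩ := Submodule.mem_sup.1 hy
    obtain ⟨c, rfl⟩ := Submodule.mem_span_singleton.1 hb
    refine ⟨(ξ, -c), ?_⟩
    simp [hw]
  have hsurj' : ∀ᶠ z in 𝓝 (v₀, (0 : ℝ)), Function.Surjective (fderiv ℝ Φ z) :=
    (hΦ.continuousAt_fderiv one_ne_zero).eventually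
      (ContinuousLinearMap.eventually_surjective hsurj)
  have hadm' : ∀ᶠ z in 𝓝 (v₀, (0 : ℝ)), z.1 ∈ admissible (affineField f₀ f) T :=
    continuousAt_fst.eventually ((isOpen_admissible hT hf₀ hf).mem_nhds hv₀a)
  have hδ' : ∀ᶠ z in 𝓝 (v₀, (0 : ℝ)), z.2 ∈ Ioo (-δ) δ := continuousAt_snd.eventually hnhds
  -- A kernel vector with `ζ.2 ≠ 0` would put `γ'` in the range of `dE~(z.1)`. Since `dΦ` is onto,
  -- `dE~(z.1)` would be onto as well, contradicting minimality of `z.1`.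
  have hconst := eventually_snd_eq_zero_of_submersion hΦ hΦ0 hsurj (by
    filter_upwards [hsurj', hadm', hδ'] with z h1 h2 h3 hz ζ hζ
    rw [(hΦd z h2 h3).fderiv] at h1 hζ
    have hz' : (endpoint (affineField f₀ f) T z.1, cost T z.1) = γ z.2 := sub_eq_zero.1 hz
    have hm : IsMinimizing (affineField f₀ f) T z.1 := isMinimizing_of_cost_le h2
      (hγZ z.2 h3).2 (congrArg Prod.fst hz') (congrArg Prod.snd hz').le
    by_contra hne
    refine hm.not_surjective hT hf₀ hf fun y => ?_
    obtain ⟨η, rfl⟩ := h1 y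
    have h4 : extendedDifferential (affineField f₀ f) T z.1 ζ.1 = ζ.2 • deriv γ z.2 :=
      sub_eq_zero.1 hζ
    refine ⟨η.1 - (η.2 / ζ.2) • ζ.1, ?_⟩
    rw [map_sub, map_smul, h4, smul_smul, div_mul_cancel₀ _ hne]
    rfl)
  have hpair : Tendsto (fun t => (v t, t)) g (𝓝 (v₀, 0)) := hvt.prodMk_nhds hg'
  obtain ⟨t, h1, h2, h3⟩ := ((hpair.eventually hconst).and
    (hgδ.and (hg self_mem_nhdsWithin : ∀ᶠ t in (g : Filter ℝ), t ∈ ({0}ᶜ : Set ℝ)))).exists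
  refine h3 (h1 ?_)
  simp only [Φ, (hv t h2).2.1, (hv t h2).2.2, Prod.mk.eta, sub_self]

end Minimizers
end

noncomputable section

/-! ### Limits of multipliers and the limiting hyperplanes -/

section Tangency

variable {X : Type*} [NormedAddCommGroup X] [NormedSpace ℝ X] {m : ℕ}
  {T : ℝ} {f₀ : X → X} {f : Fin m → X → X}

theorem abs_pairing_le (q : (X →L[ℝ] ℝ) × ℝ) (w : X × ℝ) :
    |q.1 w.1 + q.2 * w.2| ≤ 2 * ‖q‖ * ‖w‖ := by
  have h1 : |q.1 w.1| ≤ ‖q‖ * ‖w‖ := (q.1.le_opNorm w.1).trans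
    (mul_le_mul (norm_fst_le q) (norm_fst_le w) (norm_nonneg _) (norm_nonneg _))
  have h2 : |q.2 * w.2| ≤ ‖q‖ * ‖w‖ := by
    rw [abs_mul]
    exact mul_le_mul (norm_snd_le q) (norm_snd_le w) (abs_nonneg _) (norm_nonneg _)
  linarith [abs_add_le (q.1 w.1) (q.2 * w.2)]

/-- The pairing with a fixed covector. -/
def pairing (q : (X →L[ℝ] ℝ) × ℝ) : X × ℝ →ₗ[ℝ] ℝ :=
  q.1.toLinearMap.comp (LinearMap.fst ℝ X ℝ) + q.2 • LinearMap.snd ℝ X ℝ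

theorem pairing_apply (q : (X →L[ℝ] ℝ) × ℝ) (z : X × ℝ) :
    pairing q z = q.1 z.1 + q.2 * z.2 := rfl

theorem exists_pairing_ne_zero {q : (X →L[ℝ] ℝ) × ℝ} (hq : q ≠ 0) : ∃ z, pairing q z ≠ 0 := by
  by_contra! h
  refine hq (Prod.ext (ContinuousLinearMap.ext fun x => ?_) ?_)
  · simpa [pairing_apply] using h (x, 0)
  · simpa [pairing_apply] using h (0, 1)

theorem exists_generator_of_finrank_eq_one {V : Type*} [AddCommGroup V] [Module ℝ V]
    {S : Submodule ℝ V} (h : Module.finrank ℝ S = 1) :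
    ∃ v ∈ S, v ≠ 0 ∧ ∀ w ∈ S, ∃ c : ℝ, w = c • v := by
  obtain ⟨⟨v, hv⟩, h0, h1⟩ := finrank_eq_one_iff'.1 h
  refine ⟨v, hv, fun h => h0 (Subtype.ext h), fun w hw => ?_⟩
  obtain ⟨c, hc⟩ := h1 ⟨w, hw⟩
  exact ⟨c, (congrArg Subtype.val hc).symm⟩

theorem HasUniqueMultiplier.exists_generator {F : X → EuclideanSpace ℝ (Fin m) → X}
    {u : Control T m} (h : HasUniqueMultiplier F T u) :
    ∃ q₁ ∈ multipliers F T u, q₁ ≠ 0 ∧ ∀ q ∈ multipliers F T u, ∃ c : ℝ, q = c • q₁ := by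
  exact exists_generator_of_finrank_eq_one h

variable [FiniteDimensional ℝ X]

/-- If all limits of unit multipliers of minimizing controls are proportional to `q₁`, then the
tangent vectors to the graph of the value function become orthogonal to `q₁` in the limit. -/
theorem eventually_abs_pairing_le (hT : 0 ≤ T) (hf₀ : ContDiff ℝ 2 f₀)
    (hf : ∀ i, ContDiff ℝ 2 (f i)) {r : ℝ}
    (hadm : ∀ v : Control T m, cost T v ≤ r → v ∈ admissible (affineField f₀ f) T)
    {Z : Set (X × ℝ)} (hZ : Z ⊆ augmentedSublevelSet (affineField f₀ f) T r) {P : X × ℝ}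
    {q₁ : (X →L[ℝ] ℝ) × ℝ}
    (hlim : ∀ (g : Ultrafilter (X × ℝ)) (v : X × ℝ → Control T m)
      (q : X × ℝ → (X →L[ℝ] ℝ) × ℝ) (q₀ : (X →L[ℝ] ℝ) × ℝ), (g : Filter (X × ℝ)) ≤ 𝓝[Z] P →
      (∀ᶠ Q in (g : Filter (X × ℝ)), v Q ∈ admissible (affineField f₀ f) T ∧
        endpoint (affineField f₀ f) T (v Q) = Q.1 ∧ cost T (v Q) = Q.2 ∧
        q Q ∈ multipliers (affineField f₀ f) T (v Q)) →
      Tendsto q g (𝓝 q₀) → ‖q₀‖ = 1 → ∃ c : ℝ, q₀ = c • q₁) {ε : ℝ} (hε : 0 < ε) :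
    ∀ᶠ Q in 𝓝[Z] P, ∀ w ∈ tangentVectors Z Q, |q₁.1 w.1 + q₁.2 * w.2| ≤ ε * ‖w‖ := by
  refine mem_iff_ultrafilter.2 fun g hg => ?_
  by_contra hbad
  rw [← Ultrafilter.compl_mem_iff_notMem] at hbad
  have hbad' : ∀ᶠ Q in (g : Filter (X × ℝ)), ∃ (w : X × ℝ) (v : Control T m)
      (q : (X →L[ℝ] ℝ) × ℝ), ε * ‖w‖ < |q₁.1 w.1 + q₁.2 * w.2| ∧
      (v ∈ admissible (affineField f₀ f) T ∧ endpoint (affineField f₀ f) T v = Q.1 ∧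
        cost T v = Q.2 ∧ q ∈ multipliers (affineField f₀ f) T v) ∧ ‖q‖ = 1 ∧
        q.1 w.1 + q.2 * w.2 = 0 := by
    filter_upwards [hbad] with Q hQ
    simp only [mem_compl_iff, mem_ofPred_eq, not_forall, not_le] at hQ
    obtain ⟨w, hw, hlt⟩ := hQ
    obtain ⟨v, h1, h2, h3, q, h4, h5, h6⟩ := exists_multiplier_annihilating hT hf₀ hf hadm
      (tangentVectors_mono hZ Q hw)
    exact ⟨w, v, q, hlt, ⟨h1, h2, h3, h4⟩, h5, h6⟩
  choose! w v q h using fun (Q : X × ℝ) (hQ : ∃ (w : X × ℝ) (v : Control T m)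
      (q : (X →L[ℝ] ℝ) × ℝ), ε * ‖w‖ < |q₁.1 w.1 + q₁.2 * w.2| ∧
      (v ∈ admissible (affineField f₀ f) T ∧ endpoint (affineField f₀ f) T v = Q.1 ∧
        cost T v = Q.2 ∧ q ∈ multipliers (affineField f₀ f) T v) ∧ ‖q‖ = 1 ∧
        q.1 w.1 + q.2 * w.2 = 0) => hQ
  replace h := hbad'.mono h
  have : ProperSpace ((X →L[ℝ] ℝ) × ℝ) := FiniteDimensional.proper ℝ _
  obtain ⟨q₀, hq₀, hqlim⟩ := (isCompact_sphere (0 : (X →L[ℝ] ℝ) × ℝ) 1).ultrafilter_le_nhds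
    (g.map q) (le_principal_iff.2 (h.mono fun Q hQ => by
      simpa using hQ.2.2.1))
  have hq₀1 : ‖q₀‖ = 1 := by simpa using hq₀
  obtain ⟨c, hc⟩ := hlim g v q q₀ hg (h.mono fun Q hQ => hQ.2.1) hqlim hq₀1
  -- Since `q₀` is a nonzero multiple of `q₁`, smallness of `q₀` on `w` is smallness of `q₁` on `w`.
  have hc0 : c ≠ 0 := by
    rintro rfl
    rw [hc, zero_smul, norm_zero] at hq₀1
    exact zero_ne_one hq₀1
  have hdiff : Tendsto (fun Q => 2 * ‖q₀ - q Q‖) g (𝓝 0) := by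
    have : Tendsto q g (𝓝 q₀) := hqlim
    simpa using ((this.const_sub q₀).norm.const_mul 2)
  obtain ⟨Q, hQ, hsmall⟩ := (h.and (hdiff.eventually_lt_const
    (show 0 < |c| * ε by positivity))).exists
  obtain ⟨hlt, -, -, h0⟩ := hQ
  -- `q Q` kills `w Q`, so the pairing with `q₀ = c • q₁` equals the pairing with `q₀ - q Q`, which
  -- is small relative to `‖w Q‖`.
  have h1 : c * (q₁.1 (w Q).1 + q₁.2 * (w Q).2) =
      (q₀ - q Q).1 (w Q).1 + (q₀ - q Q).2 * (w Q).2 := by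
    have : (q₀ - q Q).1 (w Q).1 + (q₀ - q Q).2 * (w Q).2 = (q₀.1 (w Q).1 + q₀.2 * (w Q).2) -
        ((q Q).1 (w Q).1 + (q Q).2 * (w Q).2) := by
      simp only [Prod.fst_sub, Prod.snd_sub, sub_apply]
      ring
    rw [this, h0, hc]
    simp only [Prod.smul_fst, Prod.smul_snd, smul_apply, smul_eq_mul]
    ring
  have h2 := abs_pairing_le (q₀ - q Q) (w Q)
  rw [← h1, abs_mul] at h2
  have h3 : |c| * (ε * ‖w Q‖) < |c| * |q₁.1 (w Q).1 + q₁.2 * (w Q).2| :=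
    mul_lt_mul_of_pos_left hlt (abs_pos.2 hc0)
  have h4 := mul_le_mul_of_nonneg_right hsmall.le (norm_nonneg (w Q))
  linarith

theorem tendsto_fderiv_endpoint_apply (hT : 0 ≤ T) (hf₀ : ContDiff ℝ 2 f₀)
    (hf : ∀ i, ContDiff ℝ 2 (f i)) {u : Control T m} (hu : u ∈ admissible (affineField f₀ f) T)
    {α : Type*} {l : Filter α} {v ξ : α → Control T m} {ξ₀ : Control T m} (hv : WeakTendsto v l u)
    (hξ : WeakTendsto ξ l ξ₀) :
    Tendsto (fun k => fderiv ℝ (endpoint (affineField f₀ f) T) (v k) (ξ k)) l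
      (𝓝 (fderiv ℝ (endpoint (affineField f₀ f) T) u ξ₀)) := by
  set D := fderiv ℝ (endpoint (affineField f₀ f) T) with hD
  obtain ⟨R, hR⟩ := hξ.1
  have h1 : Tendsto (fun k => ‖D (v k) - D u‖ * R) l (𝓝 0) := by
    simpa using ((tendsto_iff_norm_sub_tendsto_zero.1
      (hv.tendsto_fderiv_endpoint hT hf₀ hf hu)).mul_const R)
  have h2 : Tendsto (fun k => (D (v k) - D u) (ξ k)) l (𝓝 0) := by
    refine squeeze_zero_norm' (hR.mono fun k hk => ?_) h1
    exact ((D (v k) - D u).le_opNorm _).trans (mul_le_mul_of_nonneg_left hk (norm_nonneg _))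
  simpa using h2.add (hξ.tendsto_clm (D u))

/-- Limits of Lagrange multipliers along weakly convergent controls are Lagrange multipliers. -/
theorem mem_multipliers_of_tendsto (hT : 0 ≤ T) (hf₀ : ContDiff ℝ 2 f₀)
    (hf : ∀ i, ContDiff ℝ 2 (f i)) {u : Control T m} (hu : u ∈ admissible (affineField f₀ f) T)
    {α : Type*} {l : Filter α} [l.NeBot] {v : α → Control T m} (hv : WeakTendsto v l u)
    {q : α → (X →L[ℝ] ℝ) × ℝ} {q₀ : (X →L[ℝ] ℝ) × ℝ}
    (hq : ∀ᶠ k in l, q k ∈ multipliers (affineField f₀ f) T (v k)) (hlim : Tendsto q l (𝓝 q₀)) :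
    q₀ ∈ multipliers (affineField f₀ f) T u := by
  refine (mem_multipliers_iff hT).2 fun ξ => ?_
  have h1 := tendsto_fderiv_endpoint_apply hT hf₀ hf hu hv
    (tendsto_const_nhds (x := ξ)).weakTendsto
  have h2 : Tendsto (fun k => inner ℝ (v k) ξ) l (𝓝 (inner ℝ u ξ)) := by
    simpa only [real_inner_comm, innerSL_apply_apply] using hv.2 (innerSL ℝ ξ)
  have hp : Tendsto (fun k => (q k).1) l (𝓝 q₀.1) := (continuous_fst.tendsto q₀).comp hlim
  have h3 := ((isBoundedBilinearMap_apply (𝕜 := ℝ)).continuous.tendsto (q₀.1, _)).comp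
    (hp.prodMk_nhds h1)
  have h4 := ((continuous_snd.tendsto q₀).comp hlim).mul (h2.const_mul 2)
  refine tendsto_nhds_unique (h3.add h4) (tendsto_const_nhds.congr' ?_)
  filter_upwards [hq] with k hk using ((mem_multipliers_iff hT).1 hk ξ).symm

/-- If the costs do not converge to the cost of the weak limit, the limit multipliers are abnormal. -/
theorem snd_eq_zero_of_tendsto (hT : 0 ≤ T) (hf₀ : ContDiff ℝ 2 f₀)
    (hf : ∀ i, ContDiff ℝ 2 (f i)) {u : Control T m} (hu : u ∈ admissible (affineField f₀ f) T)
    {α : Type*} {l : Filter α} [l.NeBot] {v : α → Control T m} (hv : WeakTendsto v l u)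
    {q : α → (X →L[ℝ] ℝ) × ℝ} {q₀ : (X →L[ℝ] ℝ) × ℝ}
    (hq : ∀ᶠ k in l, q k ∈ multipliers (affineField f₀ f) T (v k)) (hlim : Tendsto q l (𝓝 q₀))
    {s : ℝ} (hs : Tendsto (fun k => cost T (v k)) l (𝓝 s)) (hne : s ≠ cost T u) : q₀.2 = 0 := by
  have h0 := (mem_multipliers_iff hT).1 (mem_multipliers_of_tendsto hT hf₀ hf hu hv hq hlim) u
  -- The multiplier identity is tested on `v k` itself. Its limit contains `2 p⁰ s`, while the
  -- identity of the limit multiplier on `u` contains `2 p⁰ C(u)`; the other terms agree.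
  have h1 := tendsto_fderiv_endpoint_apply hT hf₀ hf hu hv hv
  have hp : Tendsto (fun k => (q k).1) l (𝓝 q₀.1) := (continuous_fst.tendsto q₀).comp hlim
  have h3 := ((isBoundedBilinearMap_apply (𝕜 := ℝ)).continuous.tendsto (q₀.1, _)).comp
    (hp.prodMk_nhds h1)
  have h4 := ((continuous_snd.tendsto q₀).comp hlim).mul (hs.const_mul 2)
  have h5 := tendsto_nhds_unique (h3.add h4) ((tendsto_const_nhds (x := (0 : ℝ))).congr' (by
    filter_upwards [hq] with k hk
    have := (mem_multipliers_iff hT).1 hk (v k)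
    rw [real_inner_self_eq_norm_sq, ← cost_eq_norm_sq hT] at this
    exact this.symm))
  rw [real_inner_self_eq_norm_sq, ← cost_eq_norm_sq hT] at h0
  have h6 : q₀.2 * (s - cost T u) = 0 := by linarith
  exact (mul_eq_zero.1 h6).resolve_right (sub_ne_zero.2 hne)

/-- Multipliers are exactly the covectors annihilating `Im dE~(u)`. If adding a vector `e` with `q₁
e ≠ 0` still left a proper subspace, there would be a multiplier not proportional to `q₁`. -/
theorem range_extendedDifferential_eq_ker (hT : 0 ≤ T) {F : X → EuclideanSpace ℝ (Fin m) → X}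
    {u : Control T m} {q₁ : (X →L[ℝ] ℝ) × ℝ} (hq₁ : q₁ ∈ multipliers F T u) (hq0 : q₁ ≠ 0)
    (hall : ∀ q ∈ multipliers F T u, ∃ c : ℝ, q = c • q₁) :
    (extendedDifferential F T u).range = LinearMap.ker (pairing q₁) := by
  have hann : ∀ z ∈ (extendedDifferential F T u).range, pairing q₁ z = 0 := by
    rintro _ ⟨ξ, rfl⟩
    have := (mem_multipliers_iff hT).1 hq₁ ξ
    rw [← fderiv_cost_apply hT] at this
    exact this
  refine le_antisymm hann fun z hz => ?_
  obtain ⟨e, he⟩ := exists_pairing_ne_zero hq0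
  by_cases htop : (extendedDifferential F T u).range ⊔ Submodule.span ℝ {e} = ⊤
  · obtain ⟨y, hy, b, hb, rfl⟩ := Submodule.mem_sup.1 (htop ▸ Submodule.mem_top :
      z ∈ (extendedDifferential F T u).range ⊔ Submodule.span ℝ {e})
    obtain ⟨c, rfl⟩ := Submodule.mem_span_singleton.1 hb
    have h1 : pairing q₁ (y + c • e) = 0 := hz
    rw [map_add, hann y hy, zero_add, map_smul, smul_eq_mul] at h1
    rw [(mul_eq_zero.1 h1).resolve_right he, zero_smul, add_zero]
    exact hy
  · exfalso
    obtain ⟨q, hq1, hq⟩ := exists_unit_functional htop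
    obtain ⟨c, rfl⟩ := hall q (mem_multipliers_of_range hT fun z hz =>
      hq z (Submodule.mem_sup_left hz))
    have h1 := hq e (Submodule.mem_sup_right (Submodule.mem_span_singleton_self e))
    have h2 : c * pairing q₁ e = 0 := by
      rw [← h1, pairing_apply]
      simp only [Prod.smul_fst, Prod.smul_snd, smul_apply, smul_eq_mul]
      ring
    rw [(mul_eq_zero.1 h2).resolve_right he, zero_smul, norm_zero] at hq1
    exact zero_ne_one hq1

/-- In corank one the annihilator of the range is a line; this supplies uniqueness among the
multipliers with `p⁰ = 0`. -/
theorem exists_abnormal_functional {L : Control T m →L[ℝ] X}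
    (hL : Module.finrank ℝ L.range + 1 = Module.finrank ℝ X) :
    ∃ p : X →L[ℝ] ℝ, p ≠ 0 ∧ L.range = LinearMap.ker p.toLinearMap ∧
      ∀ p' : X →L[ℝ] ℝ, (∀ ξ, p' (L ξ) = 0) → ∃ c : ℝ, p' = c • p := by
  have hne : L.range < ⊤ := by
    refine lt_top_iff_ne_top.2 fun h => ?_
    rw [h, finrank_top] at hL
    omega
  obtain ⟨φ, hφ, hle⟩ := L.range.exists_le_ker_of_lt_top hne
  have hker : L.range = LinearMap.ker φ := by
    refine Submodule.eq_of_le_of_finrank_eq hle ?_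
    have h1 := Module.Dual.finrank_ker_add_one_of_ne_zero hφ
    omega
  obtain ⟨e, he⟩ : ∃ e, φ e ≠ 0 := by
    by_contra! h
    exact hφ (LinearMap.ext h)
  refine ⟨φ.toContinuousLinearMap, fun h => hφ (LinearMap.ext fun x =>
    DFunLike.congr_fun h x), hker, fun p' hp' => ⟨p' e / φ e, ?_⟩⟩
  ext x
  have hx : x - (φ x / φ e) • e ∈ L.range := by
    rw [hker, LinearMap.mem_ker, map_sub, map_smul, smul_eq_mul, div_mul_cancel₀ _ he, sub_self]
  obtain ⟨ξ, hξ⟩ := hx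
  have h1 := hp' ξ
  have h2 : L ξ = x - (φ x / φ e) • e := hξ
  rw [h2, map_sub, map_smul, smul_eq_mul, sub_eq_zero] at h1
  rw [h1]
  simp only [smul_apply, LinearMap.coe_toContinuousLinearMap', smul_eq_mul]
  ring

end Tangency
end

/-! ### The tangency theorem -/

theorem mainTheorem5 (n m : ℕ) (T : ℝ) (hT : 0 < T)
    (f₀ : EuclideanSpace ℝ (Fin n) → EuclideanSpace ℝ (Fin n))
    (f : Fin m → EuclideanSpace ℝ (Fin n) → EuclideanSpace ℝ (Fin n))
    (hf₀ : AnalyticOnNhd ℝ f₀ Set.univ) (hf : ∀ i, AnalyticOnNhd ℝ (f i) Set.univ)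
    -- `r` is small enough: every control of cost at most `r` is admissible
    (r : ℝ) (hr : 0 < r)
    (hadm : ∀ v : Control T m, cost T v ≤ r → v ∈ admissible (affineField f₀ f) T)
    -- `u` is the unique minimizing control steering `0` to `A`, and `r₀ = S(A) ≤ r`
    (A : EuclideanSpace ℝ (Fin n)) (u : Control T m)
    (huA : endpoint (affineField f₀ f) T u = A)
    (hmin : IsMinimizing (affineField f₀ f) T u)
    (huniq : ∀ v : Control T m, IsMinimizing (affineField f₀ f) T v →
      endpoint (affineField f₀ f) T v = A → v = u)
    (hAr : A ∈ sublevelSet (affineField f₀ f) T r)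
    (r₀ : ℝ) (hr₀ : valueFunction (affineField f₀ f) T A = (r₀ : EReal))
    -- `u` is abnormal and `Im dE(u)` is a hyperplane
    (habn : IsAbnormal (affineField f₀ f) T u)
    (hcorank : Module.finrank ℝ (fderiv ℝ (endpoint (affineField f₀ f) T) u).range + 1 = n) :
    DifferentiableAt ℝ (endpoint (affineField f₀ f) T) u ∧
    DifferentiableAt ℝ (endpoint (extendedField (affineField f₀ f)) T) u ∧
    -- tangency in the augmented space
    (HasUniqueMultiplier (affineField f₀ f) T u →
      Module.finrank ℝ
        (fderiv ℝ (endpoint (extendedField (affineField f₀ f)) T) u).range = n ∧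
      ∀ 𝒮 : Set (Set (EuclideanSpace ℝ (Fin n) × ℝ)),
        IsC1StratificationNear (augmentedSublevelSet (affineField f₀ f) T r) (A, r₀) 𝒮 →
        ∀ N ∈ 𝒮, (A, r₀) ∈ closure N →
          StratumTangentAt (augmentedSublevelSet (affineField f₀ f) T r) N (A, r₀)
            (fderiv ℝ (endpoint (extendedField (affineField f₀ f)) T) u).range) ∧
    -- tangency of the level sets of the value function
    ∀ r₁ < r, A ∈ closure (levelSet (affineField f₀ f) T r₁) →
      r₀ ≤ r₁ ∧
      ((r₀ < r₁ ∨ HasUniqueMultiplier (affineField f₀ f) T u) →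
        (∀ v : Control T m, IsExtremal (affineField f₀ f) T v →
          endpoint (affineField f₀ f) T v = A → cost T v ≤ r₁ → v = u) →
        ∀ 𝒮 : Set (Set (EuclideanSpace ℝ (Fin n))),
          IsC1StratificationNear (levelSet (affineField f₀ f) T r₁) A 𝒮 →
          ∀ N ∈ 𝒮, A ∈ closure N →
            StratumTangentAt (levelSet (affineField f₀ f) T r₁) N A
              (fderiv ℝ (endpoint (affineField f₀ f) T) u).range) := by
  have hT' := hT.le
  have hf₀' : ContDiff ℝ 2 f₀ := contDiffOn_univ.1 (hf₀.contDiffOn uniqueDiffOn_univ)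
  have hf' : ∀ i, ContDiff ℝ 2 (f i) := fun i => contDiffOn_univ.1 ((hf i).contDiffOn uniqueDiffOn_univ)
  set F := affineField f₀ f with hF
  have hua := hmin.1
  have hext := hasFDerivAt_endpoint_extendedField hT' hf₀' hf' hua
  have hcost : cost T u = r₀ := by
    have := hmin.valueFunction_eq
    rw [huA, hr₀] at this
    exact (EReal.coe_eq_coe_iff.1 this).symm
  have hr₀r : r₀ ≤ r := EReal.coe_le_coe_iff.1 (hr₀ ▸ hAr)
  refine ⟨(contDiffAt_endpoint hT' hf₀' hf' hua).differentiableAt one_ne_zero,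
    hext.differentiableAt, fun hun => ?_, fun r₁ hr₁ hA => ?_⟩
  · rw [hext.fderiv]
    obtain ⟨q₁, hq₁, hq0, hall⟩ := hun.exists_generator
    have hker := range_extendedDifferential_eq_ker hT' hq₁ hq0 hall
    have hne : pairing q₁ ≠ 0 := fun h => by
      obtain ⟨z, hz⟩ := exists_pairing_ne_zero hq0
      exact hz (by rw [h]; rfl)
    refine ⟨?_, fun 𝒮 h𝒮 N hN _ => ?_⟩
    · rw [hker]
      have h1 := Module.Dual.finrank_ker_add_one_of_ne_zero hne
      simp only [Module.finrank_prod, finrank_euclideanSpace_fin, Module.finrank_self] at h1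
      omega
    · obtain ⟨U, dim, -, -, -, -, hcov, -⟩ := h𝒮
      refine stratumTangentAt_of_eventually
        ((subset_sUnion_of_mem hN).trans (hcov.le.trans inter_subset_left)) fun ε hε => ?_
      obtain ⟨C, hC, hinf⟩ := exists_infDist_le_abs (q := pairing q₁) (pairing q₁).isLinear
        (exists_pairing_ne_zero hq0) (H := (extendedDifferential F T u).range)
        (fun z hz => by rw [hker]; exact hz)
      -- Controls over graph points tending to `(A, r₀)` have a weak limit steering to `A` at cost
      -- at most `r₀`. It is minimizing, hence equal to `u`, so limit multipliers are multiples of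
      -- `q₁`.
      have key := eventually_abs_pairing_le hT' hf₀' hf' hadm
        (Z := augmentedSublevelSet F T r) (P := (A, r₀)) (q₁ := q₁) le_rfl (by
          intro g v q q₀ hg hv hq _
          have hgP : Tendsto id (g : Filter (EuclideanSpace ℝ (Fin n) × ℝ)) (𝓝 (A, r₀)) :=
            hg.trans nhdsWithin_le_nhds
          obtain ⟨v₀, hv₀, h1, h2, h3⟩ := exists_weak_limit hT' hf₀' hf' hadm g hr₀r
            (((continuous_fst.tendsto _).comp hgP).congr' (hv.mono fun Q hQ => hQ.2.1.symm))
            (((continuous_snd.tendsto _).comp hgP).congr' (hv.mono fun Q hQ => hQ.2.2.1.symm))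
          obtain rfl := huniq v₀ (isMinimizing_of_cost_le h1 hr₀ h2 h3) h2
          exact hall q₀ (mem_multipliers_of_tendsto hT' hf₀' hf' h1 hv₀
            (hv.mono fun Q hQ => hQ.2.2.2) hq)) (div_pos hε hC)
      filter_upwards [key] with Q hQ w hw
      refine (hinf w).trans ?_
      have := mul_le_mul_of_nonneg_left (hQ w hw) hC.le
      rwa [← mul_assoc, mul_div_cancel₀ _ hC.ne'] at this
  have hmem : ∀ x ∈ levelSet F T r₁, (x, r₁) ∈ augmentedSublevelSet F T r := fun x hx =>
    ⟨(show valueFunction F T x = r₁ from hx).le.trans (EReal.coe_le_coe_iff.2 hr₁.le), hx⟩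
  refine ⟨?_, fun hcase hextr 𝒮 h𝒮 N hN _ => ?_⟩
  -- Lower semicontinuity of the value function at `A`: a weak limit of minimizers of cost `r₁`
  -- steers to `A` at cost at most `r₁`.
  · have hex : ∀ x ∈ levelSet F T r₁, ∃ v : Control T m, endpoint F T v = x ∧ cost T v = r₁ :=
      fun x hx => by
        obtain ⟨v, -, h1, h2⟩ := exists_minimizer hT' hf₀' hf' hadm hx hr₁.le
        exact ⟨v, h1, h2⟩
    choose! v hv using hex
    have := mem_closure_iff_nhdsWithin_neBot.1 hA
    obtain ⟨g, hg⟩ : ∃ g : Ultrafilter (EuclideanSpace ℝ (Fin n)),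
        (g : Filter (EuclideanSpace ℝ (Fin n))) ≤ 𝓝[levelSet F T r₁] A := ⟨_, Ultrafilter.of_le _⟩
    have hg' := hg.trans nhdsWithin_le_nhds
    have hgm : ∀ᶠ x in (g : Filter (EuclideanSpace ℝ (Fin n))), x ∈ levelSet F T r₁ :=
      hg self_mem_nhdsWithin
    obtain ⟨v₀, -, h1, h2, h3⟩ := exists_weak_limit hT' hf₀' hf' hadm g hr₁.le
      (Tendsto.congr' (hgm.mono fun x hx => (hv x hx).1.symm) (show Tendsto id _ _ from hg'))
      (tendsto_const_nhds.congr' (hgm.mono fun x hx => (hv x hx).2.symm))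
    have := valueFunction_le_cost h1
    rw [h2, hr₀] at this
    exact (EReal.coe_le_coe_iff.1 this).trans h3
  · obtain ⟨p, hp0, hker, hp⟩ := exists_abnormal_functional (L := fderiv ℝ (endpoint F T) u)
      (by rw [hcorank, finrank_euclideanSpace_fin])
    have hpm : (p, (0 : ℝ)) ∈ multipliers F T u := (mem_multipliers_iff hT').2 fun ξ => by
      have : fderiv ℝ (endpoint F T) u ξ ∈ (fderiv ℝ (endpoint F T) u).range := ⟨ξ, rfl⟩
      rw [hker] at this
      simpa using this
    obtain ⟨U, dim, -, -, -, -, hcov, -⟩ := h𝒮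
    refine stratumTangentAt_of_eventually
      ((subset_sUnion_of_mem hN).trans (hcov.le.trans inter_subset_left)) fun ε hε => ?_
    obtain ⟨C, hC, hinf⟩ := exists_infDist_le_abs (q := p) p.toLinearMap.isLinear
      (by by_contra! h; exact hp0 (ContinuousLinearMap.ext h))
      (H := (fderiv ℝ (endpoint F T) u).range) (fun z hz => by rw [hker]; exact hz)
    -- The level set is lifted to height `r₁` in the graph, so the multiplier estimate applies
    -- around `(A, r₁)`, which lies off the graph when `r₁ > r₀`.
    have hZ : (fun x => (x, r₁)) '' levelSet F T r₁ ⊆ augmentedSublevelSet F T r := by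
      rintro _ ⟨x, hx, rfl⟩
      exact hmem x hx
    have key := eventually_abs_pairing_le hT' hf₀' hf' hadm hZ (P := (A, r₁)) (q₁ := (p, 0)) (by
      intro g v q q₀ hg hv hq hq₀
      have hgP : Tendsto id (g : Filter (EuclideanSpace ℝ (Fin n) × ℝ)) (𝓝 (A, r₁)) :=
        hg.trans nhdsWithin_le_nhds
      have hcs : Tendsto (fun Q => cost T (v Q)) g (𝓝 r₁) :=
        ((continuous_snd.tendsto _).comp hgP).congr' (hv.mono fun Q hQ => hQ.2.2.1.symm)
      obtain ⟨v₀, hv₀, h1, h2, h3⟩ := exists_weak_limit hT' hf₀' hf' hadm g hr₁.le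
        (((continuous_fst.tendsto _).comp hgP).congr' (hv.mono fun Q hQ => hQ.2.1.symm)) hcs
      have hmult : ∀ᶠ Q in (g : Filter (EuclideanSpace ℝ (Fin n) × ℝ)),
          q Q ∈ multipliers F T (v Q) := hv.mono fun Q hQ => hQ.2.2.2
      have hq₀m := mem_multipliers_of_tendsto hT' hf₀' hf' h1 hv₀ hmult hq
      have hq₀0 : q₀ ≠ 0 := by
        rintro rfl
        simp at hq₀
      -- The limit of unit multipliers is a nonzero multiplier, so the weak limit is extremal.
      obtain rfl := hextr v₀ ⟨h1, fun h => hq₀0 (by rw [h] at hq₀m; exact hq₀m)⟩ h2 h3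
      -- With `r₁ = r₀`, uniqueness of the multiplier makes `q₀` proportional to the abnormal
      -- multiplier `(p, 0)`. Otherwise the loss of cost forces `q₀.2 = 0`, and corank one
      -- concludes.
      by_cases hlt : r₁ = r₀
      · obtain ⟨q₁, -, -, hall⟩ :=
          (hcase.resolve_left (by rw [hlt]; exact lt_irrefl _)).exists_generator
        obtain ⟨a, ha⟩ := hall _ hpm
        obtain ⟨b, hb⟩ := hall _ hq₀m
        have ha0 : a ≠ 0 := by
          rintro rfl
          rw [zero_smul] at ha
          exact hp0 (congrArg Prod.fst ha)
        exact ⟨b / a, by rw [ha, smul_smul, div_mul_cancel₀ _ ha0, hb]⟩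
      · have h0 := snd_eq_zero_of_tendsto hT' hf₀' hf' h1 hv₀ hmult hq hcs (hcost ▸ hlt)
        obtain ⟨c, hc⟩ := hp q₀.1 fun ξ => by
          simpa [h0] using (mem_multipliers_iff hT').1 hq₀m ξ
        exact ⟨c, Prod.ext hc (by simp [h0])⟩) (div_pos hε hC)
    have hmap : Tendsto (fun x : EuclideanSpace ℝ (Fin n) => (x, r₁)) (𝓝[levelSet F T r₁] A)
        (𝓝[(fun x => (x, r₁)) '' levelSet F T r₁] (A, r₁)) := by
      refine tendsto_nhdsWithin_iff.2 ⟨?_, ?_⟩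
      · exact (Continuous.tendsto (by fun_prop) A).mono_left nhdsWithin_le_nhds
      · exact eventually_nhdsWithin_of_forall fun x hx => mem_image_of_mem _ hx
    filter_upwards [hmap.eventually key] with x hx w hw
    refine (hinf w).trans ?_
    -- Velocities of the level set lift to horizontal velocities, on which `(p, 0)` acts as `p` and
    -- whose norm is that of `w`.
    have hw' : (w, (0 : ℝ)) ∈ tangentVectors ((fun x => (x, r₁)) '' levelSet F T r₁) (x, r₁) := by
      obtain ⟨γ, δ, hδ, hγ, hγM, h0, hd⟩ := hw
      refine ⟨fun t => (γ t, r₁), δ, hδ, hγ.prodMk contDiffOn_const,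
        fun t ht => mem_image_of_mem _ (hγM t ht), by simp only [h0], ?_⟩
      have h1 : DifferentiableAt ℝ γ 0 := (hγ.contDiffAt
        (isOpen_Ioo.mem_nhds ⟨by linarith, hδ⟩)).differentiableAt one_ne_zero
      rw [(h1.hasDerivAt.prodMk (hasDerivAt_const (0 : ℝ) r₁)).deriv, hd]
    have h2 := hx _ hw'
    simp only [zero_mul, add_zero, Prod.norm_mk, norm_zero, norm_nonneg, sup_of_le_left] at h2
    have := mul_le_mul_of_nonneg_left h2 hC.le
    rwa [← mul_assoc, mul_div_cancel₀ _ hC.ne'] at this
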